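/- Let $\mathbf{Rel}$ be the strict monoidal category whose objects are the finite ordinals $n=\{0,\dots,n-1\}$ ($n\in\mathbb{N}$), whose morphisms $m\to n$ are the relations $R\subseteq m\times n$ with relational composition, and whose tensor product is addition on objects and disjoint union on morphisms. Let $\mathfrak{R}$ be the monoidal equational theory of *qualitative bicommutative bialgebras*: it has one generator for objects $1$, five generators for morphisms $$\mu:2\to 1,\qquad \eta:0\to 1,\qquad \delta:1\to 2,\qquad \varepsilon:1\to 0,\qquad \gamma:2\to 2,$$ and the following relations (writing $1$ also for $\mathrm{id}_1$): * symmetry: $(\gamma\otimes 1)\circ(1\otimes\gamma)\circ(\gamma\otimes 1)=(1\otimes\gamma)\circ(\gamma\otimes 1)\circ(1\otimes\gamma)$ and $\gamma\circ\gamma=\mathrm{id}_2$; * commutative monoid: $\mu\circ(\mu\otimes 1)=\mu\circ(1\otimes\mu)$, $\mu\circ(\eta\otimes 1)=1=\mu\circ(1\otimes\eta)$, $\gamma\circ(\mu\otimes 1)=(1\otimes\mu)\circ(\gamma\otimes 1)\circ(1\otimes\gamma)$, $\gamma\circ(1\otimes\mu)=(\mu\otimes 1)\circ(1\otimes\gamma)\circ(\gamma\otimes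 1)$, $\gamma\circ(\eta\otimes 1)=1\otimes\eta$, $\gamma\circ(1\otimes\eta)=\eta\otimes 1$, $\mu\circ\gamma=\mu$; * cocommutative comonoid: the eight dual relations $(\delta\otimes 1)\circ\delta=(1\otimes\delta)\circ\delta$, $(\varepsilon\otimes 1)\circ\delta=1=(1\otimes\varepsilon)\circ\delta$, $(\delta\otimes 1)\circ\gamma=(1\otimes\gamma)\circ(\gamma\otimes 1)\circ(1\otimes\delta)$, $(1\otimes\delta)\circ\gamma=(\gamma\otimes 1)\circ(1\otimes\gamma)\circ(\delta\otimes 1)$, $(\varepsilon\otimes 1)\circ\gamma=1\otimes\varepsilon$, $(1\otimes\varepsilon)\circ\gamma=\varepsilon\otimes 1$, $\gamma\circ\delta=\delta$; * bialgebra: $\delta\circ\mu=(\mu\otimes\mu)\circ(1\otimes\gamma\otimes 1)\circ(\delta\otimes\delta)$, $\varepsilon\circ\mu=\varepsilon\otimes\varepsilon$, $\delta\circ\eta=\eta\otimes\eta$, $\varepsilon\circ\eta=\mathrm{id}_0$; * qualitativity: $\mu\circ\delta=\mathrm{id}_1$. **Theorem.** The monoidal category $\mathbf{Rel}$ is presented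 by $\mathfrak{R}$. That is, let $\mathbb{R}$ be the quotient of the free strict monoidal category on the generators of $\mathfrak{R}$ by the smallest congruence (with respect to composition and tensor product) containing the relations of $\mathfrak{R}$. Then $\mathbb{R}$ and $\mathbf{Rel}$ are monoidally equivalent: there are strict monoidal functors $F:\mathbb{R}\to\mathbf{Rel}$ and $G:\mathbf{Rel}\to\mathbb{R}$ and invertible monoidal natural transformations $\mathrm{Id}_{\mathbb{R}}\to GF$ and $FG\to\mathrm{Id}_{\mathbf{Rel}}$. -/

import Mathlib

open CategoryTheory MonoidalCategory

universe v u w v₁ v₂ u₁ u₂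

/-! ### Strict monoidal categories, strict monoidal functors, monoidal equivalence -/

/-- A monoidal category is strict when its associators and unitors are identities. -/
class IsStrictMonoidal (C : Type u) [Category.{v} C] [MonoidalCategory C] : Prop where
  tensor_assoc : ∀ X Y Z : C, (X ⊗ Y) ⊗ Z = X ⊗ (Y ⊗ Z)
  unit_tensor : ∀ X : C, 𝟙_ C ⊗ X = X
  tensor_unit : ∀ X : C, X ⊗ 𝟙_ C = X
  associator_eq : ∀ X Y Z : C, (α_ X Y Z).hom = eqToHom (tensor_assoc X Y Z)
  leftUnitor_eq : ∀ X : C, (λ_ X).hom = eqToHom (unit_tensor X)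
  rightUnitor_eq : ∀ X : C, (ρ_ X).hom = eqToHom (tensor_unit X)

/-- A monoidal functor is strict when it preserves unit and tensor product on the nose, i.e. when
its structure morphisms `ε` and `μ` are identities. -/
class IsStrictMonoidalFunctor {C : Type u₁} {D : Type u₂} [Category.{v₁} C] [Category.{v₂} D]
    [MonoidalCategory C] [MonoidalCategory D] (F : C ⥤ D) [F.Monoidal] : Prop where
  obj_unit : 𝟙_ D = F.obj (𝟙_ C)
  obj_tensor : ∀ X Y : C, F.obj X ⊗ F.obj Y = F.obj (X ⊗ Y)
  ε_eq : Functor.LaxMonoidal.ε F = eqToHom obj_unit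
  μ_eq : ∀ X Y : C, Functor.LaxMonoidal.μ F X Y = eqToHom (obj_tensor X Y)

/-- Two strict monoidal categories are monoidally equivalent when there are strict monoidal
functors in both directions and invertible monoidal natural transformations between their
composites and the identity functors. -/
def MonoidallyEquivalent (C : Type u₁) (D : Type u₂) [Category.{v₁} C] [Category.{v₂} D]
    [MonoidalCategory C] [MonoidalCategory D] [IsStrictMonoidal C] [IsStrictMonoidal D] : Prop :=
  ∃ (F : C ⥤ D) (G : D ⥤ C) (_ : F.Monoidal) (_ : G.Monoidal),
    IsStrictMonoidalFunctor F ∧ IsStrictMonoidalFunctor G ∧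
    ∃ (η : 𝟭 C ≅ F ⋙ G) (ε : G ⋙ F ≅ 𝟭 D),
      NatTrans.IsMonoidal η.hom ∧ NatTrans.IsMonoidal ε.hom

/-- The usual data and laws of a strict monoidal structure, used to build instances of
`MonoidalCategory`. -/
structure StrictTensor (C : Type u) [Category.{v} C] where
  obj : C → C → C
  unit : C
  hom : ∀ {X₁ Y₁ X₂ Y₂ : C}, (X₁ ⟶ Y₁) → (X₂ ⟶ Y₂) → (obj X₁ X₂ ⟶ obj Y₁ Y₂)
  id_hom_id : ∀ X Y : C, hom (𝟙 X) (𝟙 Y) = 𝟙 (obj X Y)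
  hom_comp_hom : ∀ {X₁ Y₁ Z₁ X₂ Y₂ Z₂ : C} (f₁ : X₁ ⟶ Y₁) (f₂ : X₂ ⟶ Y₂) (g₁ : Y₁ ⟶ Z₁)
    (g₂ : Y₂ ⟶ Z₂), hom f₁ f₂ ≫ hom g₁ g₂ = hom (f₁ ≫ g₁) (f₂ ≫ g₂)
  obj_assoc : ∀ X Y Z : C, obj (obj X Y) Z = obj X (obj Y Z)
  unit_obj : ∀ X : C, obj unit X = X
  obj_unit : ∀ X : C, obj X unit = X
  hom_assoc : ∀ {X₁ Y₁ X₂ Y₂ X₃ Y₃ : C} (f₁ : X₁ ⟶ Y₁) (f₂ : X₂ ⟶ Y₂) (f₃ : X₃ ⟶ Y₃),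
    HEq (hom (hom f₁ f₂) f₃) (hom f₁ (hom f₂ f₃))
  unit_hom : ∀ {X Y : C} (f : X ⟶ Y), HEq (hom (𝟙 unit) f) f
  hom_unit : ∀ {X Y : C} (f : X ⟶ Y), HEq (hom f (𝟙 unit)) f

namespace StrictTensor

variable {C : Type u} [Category.{v} C]

theorem comp_eqToHom_of_heq {X Y X' Y' : C} {f : X ⟶ Y} {g : X' ⟶ Y'} (hX : X = X') (hY : Y = Y')
    (h : HEq f g) : f ≫ eqToHom hY = eqToHom hX ≫ g := by
  subst hX hY
  simpa using eq_of_heq h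

variable (S : StrictTensor C)

theorem hom_eqToHom_id {X Y Z : C} (h : X = Y) :
    S.hom (eqToHom h) (𝟙 Z) = eqToHom (congrArg (fun W => S.obj W Z) h) := by
  subst h
  simpa using S.id_hom_id X Z

theorem hom_id_eqToHom {X Y Z : C} (h : X = Y) :
    S.hom (𝟙 Z) (eqToHom h) = eqToHom (congrArg (fun W => S.obj Z W) h) := by
  subst h
  simpa using S.id_hom_id Z X

theorem pentagon (W X Y Z : C) :
    S.hom (eqToHom (S.obj_assoc W X Y)) (𝟙 Z) ≫ eqToHom (S.obj_assoc W (S.obj X Y) Z) ≫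
        S.hom (𝟙 W) (eqToHom (S.obj_assoc X Y Z)) =
      eqToHom (S.obj_assoc (S.obj W X) Y Z) ≫ eqToHom (S.obj_assoc W X (S.obj Y Z)) := by
  rw [hom_eqToHom_id, hom_id_eqToHom]
  simp only [eqToHom_trans]

theorem triangle (X Y : C) :
    eqToHom (S.obj_assoc X S.unit Y) ≫ S.hom (𝟙 X) (eqToHom (S.unit_obj Y)) =
      S.hom (eqToHom (S.obj_unit X)) (𝟙 Y) := by
  rw [hom_eqToHom_id, hom_id_eqToHom]
  simp only [eqToHom_trans]

/-- The underlying data: tensor product as given, structural isomorphisms identities. -/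
abbrev toStruct : MonoidalCategoryStruct C where
  tensorObj := S.obj
  tensorUnit := S.unit
  tensorHom f g := S.hom f g
  whiskerLeft X _ _ f := S.hom (𝟙 X) f
  whiskerRight f Y := S.hom f (𝟙 Y)
  associator X Y Z := eqToIso (S.obj_assoc X Y Z)
  leftUnitor X := eqToIso (S.unit_obj X)
  rightUnitor X := eqToIso (S.obj_unit X)

/-- The monoidal category given by a strict tensor product. -/
abbrev toMonoidal : MonoidalCategory C :=
  letI := S.toStruct
  MonoidalCategory.ofTensorHom
    (id_tensorHom_id := S.id_hom_id)
    (id_tensorHom := fun _ _ _ _ => rfl)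
    (tensorHom_id := fun _ _ => rfl)
    (tensorHom_comp_tensorHom := S.hom_comp_hom)
    (associator_naturality := fun f₁ f₂ f₃ =>
      comp_eqToHom_of_heq (S.obj_assoc _ _ _) (S.obj_assoc _ _ _) (S.hom_assoc f₁ f₂ f₃))
    (leftUnitor_naturality := fun f => comp_eqToHom_of_heq (S.unit_obj _) (S.unit_obj _) (S.unit_hom f))
    (rightUnitor_naturality := fun f => comp_eqToHom_of_heq (S.obj_unit _) (S.obj_unit _) (S.hom_unit f))
    (pentagon := S.pentagon)
    (triangle := S.triangle)

theorem isStrictMonoidal : @IsStrictMonoidal C _ S.toMonoidal :=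
  letI := S.toMonoidal
  { tensor_assoc := S.obj_assoc
    unit_tensor := S.unit_obj
    tensor_unit := S.obj_unit
    associator_eq := fun _ _ _ => rfl
    leftUnitor_eq := fun _ => rfl
    rightUnitor_eq := fun _ => rfl }

end StrictTensor

/-! ### Signatures and the free strict monoidal category on a signature -/

/-- A signature: generators for objects, and generators for morphisms with a source and a target
in the free monoid on the generators for objects. -/
structure MonSignature where
  Ob : Type u
  Gen : Type w
  s : Gen → FreeMonoid Ob
  t : Gen → FreeMonoid Ob

namespace MonSignature

variable (S : MonSignature.{u, w})

/-- Formal composites and tensor products of generators. -/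
inductive Term : FreeMonoid S.Ob → FreeMonoid S.Ob → Type (max u w)
  | gen (g : S.Gen) : Term (S.s g) (S.t g)
  | id (A : FreeMonoid S.Ob) : Term A A
  | comp {A B C : FreeMonoid S.Ob} (f : Term A B) (g : Term B C) : Term A C
  | tensor {A B C D : FreeMonoid S.Ob} (f : Term A B) (g : Term C D) : Term (A * C) (B * D)

variable {S}

/-- Transport of a term along equalities of its source and its target. -/
def Term.cast {A B A' B' : FreeMonoid S.Ob} (hA : A = A') (hB : B = B') (f : Term S A B) :
    Term S A' B' :=
  hA ▸ hB ▸ f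

/-- The congruence generated by the laws of strict monoidal categories. -/
inductive Term.Eqv : ∀ {A B : FreeMonoid S.Ob}, Term S A B → Term S A B → Prop
  | refl {A B} (f : Term S A B) : Eqv f f
  | symm {A B} {f g : Term S A B} : Eqv f g → Eqv g f
  | trans {A B} {f g h : Term S A B} : Eqv f g → Eqv g h → Eqv f h
  | comp_congr {A B C} {f f' : Term S A B} {g g' : Term S B C} :
      Eqv f f' → Eqv g g' → Eqv (f.comp g) (f'.comp g')
  | tensor_congr {A B C D} {f f' : Term S A B} {g g' : Term S C D} :
      Eqv f f' → Eqv g g' → Eqv (f.tensor g) (f'.tensor g')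
  | id_comp {A B} (f : Term S A B) : Eqv ((Term.id A).comp f) f
  | comp_id {A B} (f : Term S A B) : Eqv (f.comp (Term.id B)) f
  | comp_assoc {A B C D} (f : Term S A B) (g : Term S B C) (h : Term S C D) :
      Eqv ((f.comp g).comp h) (f.comp (g.comp h))
  | id_tensor_id (A B : FreeMonoid S.Ob) :
      Eqv ((Term.id A).tensor (Term.id B)) (Term.id (A * B))
  | tensor_comp_tensor {A₁ B₁ C₁ A₂ B₂ C₂} (f₁ : Term S A₁ B₁) (f₂ : Term S A₂ B₂)
      (g₁ : Term S B₁ C₁) (g₂ : Term S B₂ C₂) :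
      Eqv ((f₁.tensor f₂).comp (g₁.tensor g₂)) ((f₁.comp g₁).tensor (f₂.comp g₂))
  | tensor_assoc {A₁ B₁ A₂ B₂ A₃ B₃} (f₁ : Term S A₁ B₁) (f₂ : Term S A₂ B₂)
      (f₃ : Term S A₃ B₃) :
      Eqv (((f₁.tensor f₂).tensor f₃).cast (mul_assoc _ _ _) (mul_assoc _ _ _))
        (f₁.tensor (f₂.tensor f₃))
  | unit_tensor {A B} (f : Term S A B) :
      Eqv (((Term.id 1).tensor f).cast (one_mul _) (one_mul _)) f
  | tensor_unit {A B} (f : Term S A B) :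
      Eqv ((f.tensor (Term.id 1)).cast (mul_one _) (mul_one _)) f

/-- Terms up to the laws of strict monoidal categories. -/
instance Term.setoid (A B : FreeMonoid S.Ob) : Setoid (Term S A B) where
  r := Term.Eqv
  iseqv := ⟨Term.Eqv.refl, Term.Eqv.symm, Term.Eqv.trans⟩

variable (S)

/-- The free strict monoidal category on a signature. Its objects are the elements of the free
monoid on the generators for objects. -/
def Free : Type u := FreeMonoid S.Ob

instance : Category S.Free where
  Hom A B := Quotient (Term.setoid (S := S) A B)
  id A := Quotient.mk _ (Term.id A)
  comp := Quotient.map₂ Term.comp (fun _ _ h _ _ h' => Term.Eqv.comp_congr h h')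
  id_comp := by rintro _ _ ⟨f⟩; exact Quotient.sound (Term.Eqv.id_comp f)
  comp_id := by rintro _ _ ⟨f⟩; exact Quotient.sound (Term.Eqv.comp_id f)
  assoc := by rintro _ _ _ _ ⟨f⟩ ⟨g⟩ ⟨h⟩; exact Quotient.sound (Term.Eqv.comp_assoc f g h)

variable {S}

theorem Term.heq_of_cast {A B A' B' : FreeMonoid S.Ob} {f : Term S A B} {g : Term S A' B'}
    (hA : A = A') (hB : B = B') (h : Term.Eqv (f.cast hA hB) g) :
    HEq (Quotient.mk (Term.setoid A B) f) (Quotient.mk (Term.setoid A' B') g) := by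
  subst hA hB
  exact heq_of_eq (Quotient.sound h)

variable (S)

/-- The tensor product of the free strict monoidal category: concatenation on objects, formal
tensor product on morphisms. -/
def freeTensor : StrictTensor S.Free where
  obj A B := HMul.hMul (α := FreeMonoid S.Ob) (β := FreeMonoid S.Ob) A B
  unit := (1 : FreeMonoid S.Ob)
  hom := Quotient.map₂ Term.tensor (fun _ _ h _ _ h' => Term.Eqv.tensor_congr h h')
  id_hom_id A B := Quotient.sound (Term.Eqv.id_tensor_id A B)
  hom_comp_hom := by
    rintro _ _ _ _ _ _ ⟨f₁⟩ ⟨f₂⟩ ⟨g₁⟩ ⟨g₂⟩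
    exact Quotient.sound (Term.Eqv.tensor_comp_tensor f₁ f₂ g₁ g₂)
  obj_assoc A B C := mul_assoc (G := FreeMonoid S.Ob) A B C
  unit_obj A := one_mul (M := FreeMonoid S.Ob) A
  obj_unit A := mul_one (M := FreeMonoid S.Ob) A
  hom_assoc := by
    rintro _ _ _ _ _ _ ⟨f₁⟩ ⟨f₂⟩ ⟨f₃⟩
    exact Term.heq_of_cast _ _ (Term.Eqv.tensor_assoc f₁ f₂ f₃)
  unit_hom := by
    rintro _ _ ⟨f⟩
    exact Term.heq_of_cast _ _ (Term.Eqv.unit_tensor f)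
  hom_unit := by
    rintro _ _ ⟨f⟩
    exact Term.heq_of_cast _ _ (Term.Eqv.tensor_unit f)

instance : MonoidalCategory S.Free := S.freeTensor.toMonoidal

instance : IsStrictMonoidal S.Free := S.freeTensor.isStrictMonoidal

variable {S}

/-- A generator, seen as a morphism of the free strict monoidal category. -/
def gen (g : S.Gen) : @Quiver.Hom S.Free _ (S.s g) (S.t g) :=
  Quotient.mk (Term.setoid (S := S) (S.s g) (S.t g)) (Term.gen g)

end MonSignature

/-! ### Monoidal equational theories and presentations -/

/-- A pair of morphisms with the same source and the same target. -/
structure ParallelPair (C : Type u) [Category.{v} C] where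
  {src : C}
  {tgt : C}
  lhs : src ⟶ tgt
  rhs : src ⟶ tgt

/-- A monoidal equational theory: a signature and a family of pairs of parallel morphisms of the
free strict monoidal category on it. -/
structure MonTheory extends MonSignature.{u, w} where
  Idx : Type v
  rel : Idx → ParallelPair toMonSignature.Free

namespace MonTheory

variable (T : MonTheory.{v, u, w})

/-- The smallest congruence, with respect to composition and tensor product, that identifies the
two sides of every relation of the theory. -/
inductive Cong : ∀ {A B : T.toMonSignature.Free}, (A ⟶ B) → (A ⟶ B) → Prop
  | of (e : T.Idx) : Cong (T.rel e).lhs (T.rel e).rhs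
  | refl {A B} (f : A ⟶ B) : Cong f f
  | symm {A B} {f g : A ⟶ B} : Cong f g → Cong g f
  | trans {A B} {f g h : A ⟶ B} : Cong f g → Cong g h → Cong f h
  | comp_congr {A B C} {f f' : A ⟶ B} {g g' : B ⟶ C} :
      Cong f f' → Cong g g' → Cong (f ≫ g) (f' ≫ g')
  | tensor_congr {A B C D} {f f' : A ⟶ B} {g g' : C ⟶ D} :
      Cong f f' → Cong g g' → Cong (f ⊗ₘ g) (f' ⊗ₘ g')

/-- Morphisms of the free category up to the congruence generated by the relations. -/
instance congSetoid (A B : T.toMonSignature.Free) : Setoid (A ⟶ B) where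
  r := T.Cong
  iseqv := ⟨Cong.refl, Cong.symm, Cong.trans⟩

/-- The monoidal category generated by a theory: the free strict monoidal category on its
signature, with morphisms taken up to the congruence generated by its relations. -/
def Generated : Type u := T.toMonSignature.Free

instance : Category T.Generated where
  Hom A B := Quotient (T.congSetoid A B)
  id A := Quotient.mk (T.congSetoid A A) (CategoryStruct.id (obj := T.toMonSignature.Free) A)
  comp := Quotient.map₂ (fun f g => f ≫ g) (fun _ _ h _ _ h' => Cong.comp_congr h h')
  id_comp := by rintro _ _ ⟨f⟩; exact congrArg (Quotient.mk _) (Category.id_comp f)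
  comp_id := by rintro _ _ ⟨f⟩; exact congrArg (Quotient.mk _) (Category.comp_id f)
  assoc := by
    rintro _ _ _ _ ⟨f⟩ ⟨g⟩ ⟨h⟩
    exact congrArg (Quotient.mk _) (Category.assoc f g h)

theorem heq_mk {A B A' B' : T.toMonSignature.Free} {f : A ⟶ B} {g : A' ⟶ B'}
    (hA : A = A') (hB : B = B') (h : HEq f g) :
    HEq (Quotient.mk (T.congSetoid A B) f) (Quotient.mk (T.congSetoid A' B') g) := by
  subst hA hB
  exact heq_of_eq (congrArg _ (eq_of_heq h))

/-- The tensor product of the generated category, induced by that of the free category. -/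
def generatedTensor : StrictTensor T.Generated where
  obj := T.toMonSignature.freeTensor.obj
  unit := T.toMonSignature.freeTensor.unit
  hom := Quotient.map₂ T.toMonSignature.freeTensor.hom (fun _ _ h _ _ h' => Cong.tensor_congr h h')
  id_hom_id A B := congrArg (Quotient.mk _) (T.toMonSignature.freeTensor.id_hom_id A B)
  hom_comp_hom := by
    rintro _ _ _ _ _ _ ⟨f₁⟩ ⟨f₂⟩ ⟨g₁⟩ ⟨g₂⟩
    exact congrArg (Quotient.mk _) (T.toMonSignature.freeTensor.hom_comp_hom f₁ f₂ g₁ g₂)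
  obj_assoc := T.toMonSignature.freeTensor.obj_assoc
  unit_obj := T.toMonSignature.freeTensor.unit_obj
  obj_unit := T.toMonSignature.freeTensor.obj_unit
  hom_assoc := by
    rintro _ _ _ _ _ _ ⟨f₁⟩ ⟨f₂⟩ ⟨f₃⟩
    exact T.heq_mk (T.toMonSignature.freeTensor.obj_assoc _ _ _)
      (T.toMonSignature.freeTensor.obj_assoc _ _ _)
      (T.toMonSignature.freeTensor.hom_assoc f₁ f₂ f₃)
  unit_hom := by
    rintro _ _ ⟨f⟩
    exact T.heq_mk (T.toMonSignature.freeTensor.unit_obj _)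
      (T.toMonSignature.freeTensor.unit_obj _) (T.toMonSignature.freeTensor.unit_hom f)
  hom_unit := by
    rintro _ _ ⟨f⟩
    exact T.heq_mk (T.toMonSignature.freeTensor.obj_unit _)
      (T.toMonSignature.freeTensor.obj_unit _) (T.toMonSignature.freeTensor.hom_unit f)

instance : MonoidalCategory T.Generated := T.generatedTensor.toMonoidal

instance : IsStrictMonoidal T.Generated := T.generatedTensor.isStrictMonoidal

/-- A theory presents a strict monoidal category when the category it generates is monoidally
equivalent to that category. -/
def Presents (M : Type u₁) [Category.{v₁} M] [MonoidalCategory M] [IsStrictMonoidal M] : Prop :=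
  MonoidallyEquivalent T.Generated M

end MonTheory

/-! ### The theory of qualitative bicommutative bialgebras -/

namespace Bialg

/-- The generators for morphisms of the theory of bialgebras. -/
inductive Gen : Type
  | mu | eta | delta | eps | gamma

/-- The object `1`, generating the free monoid of objects. -/
abbrev one : FreeMonoid Unit := FreeMonoid.of ()

/-- The signature with one generator for objects `1` and five generators for morphisms
`μ : 2 → 1`, `η : 0 → 1`, `δ : 1 → 2`, `ε : 1 → 0` and `γ : 2 → 2`. -/
def sig : MonSignature.{0, 0} where
  Ob := Unit
  Gen := Gen
  s
    | .mu => one * one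
    | .eta => 1
    | .delta => one
    | .eps => one
    | .gamma => one * one
  t
    | .mu => one
    | .eta => one
    | .delta => one * one
    | .eps => 1
    | .gamma => one * one

/-- The generating object. -/
def X : sig.Free := one

/-- The multiplication. -/
def μ : X ⊗ X ⟶ X := MonSignature.gen (S := sig) Gen.mu

/-- The unit. -/
def η : 𝟙_ sig.Free ⟶ X := MonSignature.gen (S := sig) Gen.eta

/-- The comultiplication. -/
def δ : X ⟶ X ⊗ X := MonSignature.gen (S := sig) Gen.delta

/-- The counit. -/
def ε : X ⟶ 𝟙_ sig.Free := MonSignature.gen (S := sig) Gen.eps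

/-- The symmetry. -/
def γ : X ⊗ X ⟶ X ⊗ X := MonSignature.gen (S := sig) Gen.gamma

/-- Names of the twenty-two relations of the theory of bicommutative bialgebras. -/
inductive RelName : Type
  | yangBaxter | symSym
  | mulAssoc | unitMul | mulUnit | mulSymLeft | mulSymRight | unitSymLeft | unitSymRight | mulComm
  | comulCoassoc | counitComul | comulCounit | comulSymLeft | comulSymRight
  | counitSymLeft | counitSymRight | comulCocomm
  | mulComul | mulCounit | unitComul | unitCounit

/-- The twenty-two relations of the theory of bicommutative bialgebras. The structural
isomorphisms `α_`, `λ_`, `ρ_` are identities, the category being strict. -/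
def rel : RelName → ParallelPair sig.Free
  | .yangBaxter =>
      ⟨γ ▷ X ≫ (α_ X X X).hom ≫ X ◁ γ ≫ (α_ X X X).inv ≫ γ ▷ X,
        (α_ X X X).hom ≫ X ◁ γ ≫ (α_ X X X).inv ≫ γ ▷ X ≫ (α_ X X X).hom ≫ X ◁ γ ≫
          (α_ X X X).inv⟩
  | .symSym => ⟨γ ≫ γ, 𝟙 (X ⊗ X)⟩
  | .mulAssoc => ⟨μ ▷ X ≫ μ, (α_ X X X).hom ≫ X ◁ μ ≫ μ⟩
  | .unitMul => ⟨(λ_ X).inv ≫ η ▷ X ≫ μ, 𝟙 X⟩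
  | .mulUnit => ⟨(ρ_ X).inv ≫ X ◁ η ≫ μ, 𝟙 X⟩
  | .mulSymLeft =>
      ⟨μ ▷ X ≫ γ,
        (α_ X X X).hom ≫ X ◁ γ ≫ (α_ X X X).inv ≫ γ ▷ X ≫ (α_ X X X).hom ≫ X ◁ μ⟩
  | .mulSymRight =>
      ⟨X ◁ μ ≫ γ,
        (α_ X X X).inv ≫ γ ▷ X ≫ (α_ X X X).hom ≫ X ◁ γ ≫ (α_ X X X).inv ≫ μ ▷ X⟩
  | .unitSymLeft => ⟨(λ_ X).inv ≫ η ▷ X ≫ γ, (ρ_ X).inv ≫ X ◁ η⟩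
  | .unitSymRight => ⟨(ρ_ X).inv ≫ X ◁ η ≫ γ, (λ_ X).inv ≫ η ▷ X⟩
  | .mulComm => ⟨γ ≫ μ, μ⟩
  | .comulCoassoc => ⟨δ ≫ δ ▷ X, δ ≫ X ◁ δ ≫ (α_ X X X).inv⟩
  | .counitComul => ⟨δ ≫ ε ▷ X ≫ (λ_ X).hom, 𝟙 X⟩
  | .comulCounit => ⟨δ ≫ X ◁ ε ≫ (ρ_ X).hom, 𝟙 X⟩
  | .comulSymLeft =>
      ⟨γ ≫ δ ▷ X,
        X ◁ δ ≫ (α_ X X X).inv ≫ γ ▷ X ≫ (α_ X X X).hom ≫ X ◁ γ ≫ (α_ X X X).inv⟩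
  | .comulSymRight =>
      ⟨γ ≫ X ◁ δ,
        δ ▷ X ≫ (α_ X X X).hom ≫ X ◁ γ ≫ (α_ X X X).inv ≫ γ ▷ X ≫ (α_ X X X).hom⟩
  | .counitSymLeft => ⟨γ ≫ ε ▷ X ≫ (λ_ X).hom, X ◁ ε ≫ (ρ_ X).hom⟩
  | .counitSymRight => ⟨γ ≫ X ◁ ε ≫ (ρ_ X).hom, ε ▷ X ≫ (λ_ X).hom⟩
  | .comulCocomm => ⟨δ ≫ γ, δ⟩
  | .mulComul =>
      ⟨μ ≫ δ,
        (δ ⊗ₘ δ) ≫ (α_ X X (X ⊗ X)).hom ≫ X ◁ (α_ X X X).inv ≫ X ◁ (γ ▷ X) ≫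
          X ◁ (α_ X X X).hom ≫ (α_ X X (X ⊗ X)).inv ≫ (μ ⊗ₘ μ)⟩
  | .mulCounit => ⟨μ ≫ ε, (ε ⊗ₘ ε) ≫ (λ_ (𝟙_ sig.Free)).hom⟩
  | .unitComul => ⟨η ≫ δ, (λ_ (𝟙_ sig.Free)).inv ≫ (η ⊗ₘ η)⟩
  | .unitCounit => ⟨η ≫ ε, 𝟙 (𝟙_ sig.Free)⟩

/-- The equational theory of bicommutative bialgebras. -/
def theory : MonTheory.{0, 0, 0} where
  toMonSignature := sig
  Idx := RelName
  rel := rel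

/-- The equational theory of qualitative bicommutative bialgebras: the theory of bicommutative
bialgebras with the additional relation `μ ∘ δ = id`, indexed by `none`. -/
def qualitativeTheory : MonTheory.{0, 0, 0} where
  toMonSignature := sig
  Idx := Option RelName
  rel
    | none => ⟨δ ≫ μ, 𝟙 X⟩
    | some e => rel e

end Bialg

/-! ### The category of finite ordinals and relations -/

/-- The objects of the category of finite ordinals and relations: `n` stands for the finite
ordinal `{0, …, n - 1}`. -/
def FinOrdRel : Type := ℕ

namespace FinOrdRel

/-- Morphisms `m ⟶ n` are relations between `Fin m` and `Fin n`, with relational composition. -/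
instance : Category FinOrdRel where
  Hom m n := Fin m → Fin n → Prop
  id _ := Eq
  comp R S := Relation.Comp R S
  id_comp _ := Relation.eq_comp
  comp_id _ := Relation.comp_eq
  assoc _ _ _ := Relation.comp_assoc

/-- The disjoint union of two relations, `Fin (m + n)` being the disjoint union of `Fin m`,
placed first, and `Fin n`. -/
def sumRel {m n m' n' : ℕ} (R : Fin m → Fin n → Prop) (R' : Fin m' → Fin n' → Prop) :
    Fin (m + m') → Fin (n + n') → Prop :=
  fun i j => Sum.LiftRel R R' (finSumFinEquiv.symm i) (finSumFinEquiv.symm j)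

theorem sumRel_iff {m n m' n' : ℕ} (R : Fin m → Fin n → Prop) (R' : Fin m' → Fin n' → Prop)
    (i : Fin (m + m')) (j : Fin (n + n')) :
    sumRel R R' i j ↔
      (∃ (a : Fin m) (b : Fin n), (i : ℕ) = a ∧ (j : ℕ) = b ∧ R a b) ∨
      (∃ (a : Fin m') (b : Fin n'), (i : ℕ) = m + a ∧ (j : ℕ) = n + b ∧ R' a b) := by
  obtain ⟨x, rfl⟩ := finSumFinEquiv.surjective i
  obtain ⟨y, rfl⟩ := finSumFinEquiv.surjective j
  simp only [sumRel, Equiv.symm_apply_apply]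
  constructor
  · rintro (h | h)
    · exact Or.inl ⟨_, _, by simp, by simp, h⟩
    · exact Or.inr ⟨_, _, by simp, by simp, h⟩
  · rcases x with x | x <;> rcases y with y | y <;>
      rintro (⟨a, b, ha, hb, h⟩ | ⟨a, b, ha, hb, h⟩) <;>
      simp only [finSumFinEquiv_apply_left, finSumFinEquiv_apply_right, Fin.val_castAdd,
        Fin.val_natAdd] at ha hb
    · obtain rfl := Fin.ext ha
      obtain rfl := Fin.ext hb
      exact .inl h
    all_goals first
      | (exfalso; omega)
      | skip
    obtain rfl : x = a := Fin.ext (by omega)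
    obtain rfl : y = b := Fin.ext (by omega)
    exact .inr h

theorem heq_of_iff {m n m' n' : ℕ} {R : Fin m → Fin n → Prop} {R' : Fin m' → Fin n' → Prop}
    (hm : m = m') (hn : n = n')
    (h : ∀ (i : Fin m) (j : Fin n), R i j ↔ R' (i.cast hm) (j.cast hn)) : HEq R R' := by
  subst hm hn
  exact heq_of_eq (funext fun i => funext fun j => propext (h i j))

theorem sumRel_eq (m n : ℕ) : sumRel (@Eq (Fin m)) (@Eq (Fin n)) = Eq := by
  funext i j
  obtain ⟨x, rfl⟩ := finSumFinEquiv.surjective i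
  obtain ⟨y, rfl⟩ := finSumFinEquiv.surjective j
  simp only [sumRel, Equiv.symm_apply_apply, EmbeddingLike.apply_eq_iff_eq]
  rcases x with x | x <;> rcases y with y | y <;> simp

theorem sumRel_comp {m n p m' n' p' : ℕ} (R : Fin m → Fin n → Prop) (R' : Fin m' → Fin n' → Prop)
    (S : Fin n → Fin p → Prop) (S' : Fin n' → Fin p' → Prop) :
    Relation.Comp (sumRel R R') (sumRel S S') =
      sumRel (Relation.Comp R S) (Relation.Comp R' S') := by
  funext i k
  obtain ⟨x, rfl⟩ := finSumFinEquiv.surjective i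
  obtain ⟨z, rfl⟩ := finSumFinEquiv.surjective k
  simp only [Relation.Comp, sumRel, Equiv.symm_apply_apply]
  rw [finSumFinEquiv.symm.exists_congr_left]
  rcases x with x | x <;> rcases z with z | z <;> simp [Relation.Comp]

theorem sumRel_assoc {m n m' n' m'' n'' : ℕ} (R : Fin m → Fin n → Prop)
    (R' : Fin m' → Fin n' → Prop) (R'' : Fin m'' → Fin n'' → Prop) :
    HEq (sumRel (sumRel R R') R'') (sumRel R (sumRel R' R'')) := by
  refine heq_of_iff (Nat.add_assoc _ _ _) (Nat.add_assoc _ _ _) fun i j => ?_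
  simp only [sumRel_iff, Fin.val_cast]
  constructor
  · rintro (⟨a, b, ha, hb, (⟨c, d, hc, hd, h⟩ | ⟨c, d, hc, hd, h⟩)⟩ | ⟨a, b, ha, hb, h⟩)
    · exact Or.inl ⟨c, d, by omega, by omega, h⟩
    · exact Or.inr ⟨Fin.castAdd _ c, Fin.castAdd _ d, by simp; omega, by simp; omega,
        Or.inl ⟨c, d, by simp, by simp, h⟩⟩
    · exact Or.inr ⟨Fin.natAdd _ a, Fin.natAdd _ b, by simp; omega, by simp; omega,
        Or.inr ⟨a, b, by simp, by simp, h⟩⟩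
  · rintro (⟨a, b, ha, hb, h⟩ | ⟨a, b, ha, hb, (⟨c, d, hc, hd, h⟩ | ⟨c, d, hc, hd, h⟩)⟩)
    · exact Or.inl ⟨Fin.castAdd _ a, Fin.castAdd _ b, by simp; omega, by simp; omega,
        Or.inl ⟨a, b, by simp, by simp, h⟩⟩
    · exact Or.inl ⟨Fin.natAdd _ c, Fin.natAdd _ d, by simp; omega, by simp; omega,
        Or.inr ⟨c, d, by simp, by simp, h⟩⟩
    · exact Or.inr ⟨c, d, by omega, by omega, h⟩

theorem unit_sumRel {m n : ℕ} (R : Fin m → Fin n → Prop) :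
    HEq (sumRel (@Eq (Fin 0)) R) R := by
  refine heq_of_iff (Nat.zero_add _) (Nat.zero_add _) fun i j => ?_
  rw [sumRel_iff]
  constructor
  · rintro (⟨a, _⟩ | ⟨a, b, ha, hb, h⟩)
    · exact a.elim0
    · convert h using 1 <;> ext <;> simp [ha, hb]
  · exact fun h => Or.inr ⟨_, _, by simp, by simp, h⟩

theorem sumRel_unit {m n : ℕ} (R : Fin m → Fin n → Prop) :
    HEq (sumRel R (@Eq (Fin 0))) R := by
  refine heq_of_iff (Nat.add_zero _) (Nat.add_zero _) fun i j => ?_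
  rw [sumRel_iff]
  constructor
  · rintro (⟨a, b, ha, hb, h⟩ | ⟨a, _⟩)
    · convert h using 1 <;> ext <;> simp [ha, hb]
    · exact a.elim0
  · exact fun h => Or.inl ⟨_, _, by simp, by simp, h⟩

/-- The tensor product of relations: addition on objects, disjoint union on morphisms. -/
def tensor : StrictTensor FinOrdRel where
  obj m n := HAdd.hAdd (α := ℕ) (β := ℕ) m n
  unit := (0 : ℕ)
  hom R R' := sumRel R R'
  id_hom_id m n := sumRel_eq m n
  hom_comp_hom R₁ R₂ S₁ S₂ := sumRel_comp R₁ R₂ S₁ S₂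
  obj_assoc := Nat.add_assoc
  unit_obj := Nat.zero_add
  obj_unit := Nat.add_zero
  hom_assoc R₁ R₂ R₃ := sumRel_assoc R₁ R₂ R₃
  unit_hom R := unit_sumRel R
  hom_unit R := sumRel_unit R

instance : MonoidalCategory FinOrdRel := tensor.toMonoidal

instance : IsStrictMonoidal FinOrdRel := tensor.isStrictMonoidal

end FinOrdRel

/-! The relations describe a commutative monoid object, with idempotent multiplication, in a
category whose tensor product is the cartesian product. The symmetry relations extend `swap` to a
symmetry on all objects, and the comonoid on `pt` extends to copying `diag` and deleting `discard`
on all objects. The relations also make every generator commute with copying and deleting, hence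
every morphism does (`comp_diag`, `comp_discard`). By Fox's theorem the tensor product is then the
categorical product.

A morphism `A ⟶ B` is therefore a tuple of `len B` morphisms `A ⟶ pt`. The monoid `pt` turns the
morphisms `A ⟶ pt` into a commutative monoid, which `comul_mul` makes idempotent. Each of its
elements is a product of distinct coordinate projections (`mem_col`), because tuples of such
products are stable under composition with every generator (`comp_mem_cols`). So a morphism `A ⟶ pt`
amounts to a subset of the `len A` coordinates, and a morphism `A ⟶ B` to a relation.

The interpretation `Eval` respects the relations of the theory and recovers these subsets, which
gives faithfulness (`col_ext`, `hom_ext_of_eval`); every relation is realised by joins of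
projections (`exists_eval`). The functor `toRel` is thus fully faithful, bijective on objects and
compatible with tensor products, and `monoidallyEquivalent_of_bijective` yields the strict
equivalence. -/

namespace Bialg

/-! ### The generated category and its defining relations -/

/-- The monoidal category generated by the theory of qualitative bicommutative bialgebras. -/
abbrev QBialg : Type := qualitativeTheory.Generated

namespace QBialg

/-- The image of a morphism of the free monoidal category in the generated category. -/
def cls {A B : sig.Free} (f : A ⟶ B) : @Quiver.Hom QBialg _ A B :=
  Quotient.mk (qualitativeTheory.congSetoid A B) f

/-- The generating object. -/
def pt : QBialg := Bialg.X

/-- The multiplication. -/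
def mul : pt ⊗ pt ⟶ pt := cls Bialg.μ

/-- The unit. -/
def unit : 𝟙_ QBialg ⟶ pt := cls Bialg.η

/-- The comultiplication. -/
def comul : pt ⟶ pt ⊗ pt := cls Bialg.δ

/-- The counit. -/
def counit : pt ⟶ 𝟙_ QBialg := cls Bialg.ε

/-- The symmetry. -/
def swap : pt ⊗ pt ⟶ pt ⊗ pt := cls Bialg.γ

theorem cls_rel (e : RelName) : cls (rel e).lhs = cls (rel e).rhs :=
  Quotient.sound (MonTheory.Cong.of (T := qualitativeTheory) (some e))

theorem comul_mul : comul ≫ mul = 𝟙 pt :=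
  Quotient.sound (MonTheory.Cong.of (T := qualitativeTheory) none)

theorem swap_swap : swap ≫ swap = 𝟙 (pt ⊗ pt) := cls_rel .symSym

theorem yangBaxter :
    swap ▷ pt ≫ (α_ pt pt pt).hom ≫ pt ◁ swap ≫ (α_ pt pt pt).inv ≫ swap ▷ pt =
      (α_ pt pt pt).hom ≫ pt ◁ swap ≫ (α_ pt pt pt).inv ≫ swap ▷ pt ≫ (α_ pt pt pt).hom ≫
        pt ◁ swap ≫ (α_ pt pt pt).inv := cls_rel .yangBaxter

theorem mul_assoc : mul ▷ pt ≫ mul = (α_ pt pt pt).hom ≫ pt ◁ mul ≫ mul := cls_rel .mulAssoc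

theorem unit_mul : (λ_ pt).inv ≫ unit ▷ pt ≫ mul = 𝟙 pt := cls_rel .unitMul

theorem mul_unit : (ρ_ pt).inv ≫ pt ◁ unit ≫ mul = 𝟙 pt := cls_rel .mulUnit

theorem mul_swap : pt ◁ mul ≫ swap = (α_ pt pt pt).inv ≫ swap ▷ pt ≫ (α_ pt pt pt).hom ≫
    pt ◁ swap ≫ (α_ pt pt pt).inv ≫ mul ▷ pt := cls_rel .mulSymRight

theorem unit_swap : (ρ_ pt).inv ≫ pt ◁ unit ≫ swap = (λ_ pt).inv ≫ unit ▷ pt :=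
  cls_rel .unitSymRight

theorem swap_mul : swap ≫ mul = mul := cls_rel .mulComm

theorem comul_coassoc : comul ≫ comul ▷ pt = comul ≫ pt ◁ comul ≫ (α_ pt pt pt).inv :=
  cls_rel .comulCoassoc

theorem counit_comul : comul ≫ counit ▷ pt ≫ (λ_ pt).hom = 𝟙 pt := cls_rel .counitComul

theorem comul_counit : comul ≫ pt ◁ counit ≫ (ρ_ pt).hom = 𝟙 pt := cls_rel .comulCounit

theorem swap_comul : swap ≫ comul ▷ pt = pt ◁ comul ≫ (α_ pt pt pt).inv ≫ swap ▷ pt ≫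
    (α_ pt pt pt).hom ≫ pt ◁ swap ≫ (α_ pt pt pt).inv := cls_rel .comulSymLeft

theorem swap_counit : swap ≫ counit ▷ pt ≫ (λ_ pt).hom = pt ◁ counit ≫ (ρ_ pt).hom :=
  cls_rel .counitSymLeft

theorem comul_swap : comul ≫ swap = comul := cls_rel .comulCocomm

theorem mul_comul : mul ≫ comul = (comul ⊗ₘ comul) ≫ (α_ pt pt (pt ⊗ pt)).hom ≫
    pt ◁ (α_ pt pt pt).inv ≫ pt ◁ (swap ▷ pt) ≫ pt ◁ (α_ pt pt pt).hom ≫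
      (α_ pt pt (pt ⊗ pt)).inv ≫ (mul ⊗ₘ mul) := cls_rel .mulComul

theorem mul_counit : mul ≫ counit = (counit ⊗ₘ counit) ≫ (λ_ (𝟙_ QBialg)).hom :=
  cls_rel .mulCounit

theorem unit_comul : unit ≫ comul = (λ_ (𝟙_ QBialg)).inv ≫ (unit ⊗ₘ unit) := cls_rel .unitComul

theorem unit_counit : unit ≫ counit = 𝟙 (𝟙_ QBialg) := cls_rel .unitCounit

/-- Recursion on the number of factors of an object. -/
def objRec {P : QBialg → Sort*} (one : P (𝟙_ QBialg)) (cons : ∀ A : QBialg, P A → P (pt ⊗ A)) :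
    ∀ A : QBialg, P A :=
  @List.rec Unit P one (fun _ A ih => cons A ih)

/-- Induction on the formation of a morphism from the generators. -/
theorem homInd {P : ∀ {A B : QBialg}, (A ⟶ B) → Prop} (hmul : P mul) (hunit : P unit)
    (hcomul : P comul) (hcounit : P counit) (hswap : P swap) (hid : ∀ A : QBialg, P (𝟙 A))
    (hcomp : ∀ {A B C : QBialg} (f : A ⟶ B) (g : B ⟶ C), P f → P g → P (f ≫ g))
    (htensor : ∀ {A B C D : QBialg} (f : A ⟶ B) (g : C ⟶ D), P f → P g → P (f ⊗ₘ g))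
    {A B : QBialg} (f : A ⟶ B) : P f := by
  have key : ∀ {A B : FreeMonoid sig.Ob} (t : MonSignature.Term sig A B),
      P (cls (Quotient.mk (MonSignature.Term.setoid A B) t)) := by
    intro A B t
    induction t with
    | gen g => cases g <;> assumption
    | id A => exact hid A
    | comp f g hf hg => exact hcomp _ _ hf hg
    | tensor f g hf hg => exact htensor _ _ hf hg
  obtain ⟨⟨t⟩⟩ := f
  exact key t

/-! ### Extension of the symmetry to all objects -/

/-- The symmetry of `pt` with an arbitrary object. -/
def swapPt : ∀ A : QBialg, pt ⊗ A ⟶ A ⊗ pt :=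
  objRec ((ρ_ pt).hom ≫ (λ_ pt).inv) fun A c =>
    (α_ pt pt A).inv ≫ swap ▷ A ≫ (α_ pt pt A).hom ≫ pt ◁ c ≫ (α_ pt A pt).inv

theorem swapPt_one : swapPt (𝟙_ QBialg) = (ρ_ pt).hom ≫ (λ_ pt).inv := rfl

theorem swapPt_cons (A : QBialg) : swapPt (pt ⊗ A) =
    (α_ pt pt A).inv ≫ swap ▷ A ≫ (α_ pt pt A).hom ≫ pt ◁ swapPt A ≫ (α_ pt A pt).inv := rfl

/-- Recursion on words only computes on objects of the form `pt ⊗ A`. Other bracketings are first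
moved to that form along an equality of objects, which is a structural isomorphism since the
category is strict. The later `_congr` lemmas serve the same purpose. -/
theorem swapPt_congr {A B : QBialg} (h : A = B) :
    swapPt A = pt ◁ eqToHom h ≫ swapPt B ≫ eqToHom h.symm ▷ pt := by
  subst h
  simp

theorem swapPt_pt : swapPt pt = swap := by
  have h : swapPt pt = pt ◁ (ρ_ pt).inv ≫ swapPt (pt ⊗ 𝟙_ QBialg) ≫ (ρ_ pt).hom ▷ pt :=
    swapPt_congr (IsStrictMonoidal.tensor_unit pt).symm
  rw [h, swapPt_cons, swapPt_one]
  simp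

theorem swapPt_tensor (A B : QBialg) : swapPt (A ⊗ B) =
    (α_ pt A B).inv ≫ swapPt A ▷ B ≫ (α_ A pt B).hom ≫ A ◁ swapPt B ≫ (α_ A B pt).inv := by
  induction A using objRec with
  | one =>
    have h : swapPt (𝟙_ QBialg ⊗ B) = pt ◁ (λ_ B).hom ≫ swapPt B ≫ (λ_ B).inv ▷ pt :=
      swapPt_congr (IsStrictMonoidal.unit_tensor B)
    rw [h, swapPt_one]
    monoidal
  | cons A ih =>
    have h : swapPt ((pt ⊗ A) ⊗ B) =
        pt ◁ (α_ pt A B).hom ≫ swapPt (pt ⊗ (A ⊗ B)) ≫ (α_ pt A B).inv ▷ pt :=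
      swapPt_congr (IsStrictMonoidal.tensor_assoc pt A B)
    rw [h, swapPt_cons, swapPt_cons, ih]
    monoidal

/-- On the generators, this naturality is what the relations between `swap` and each generator say,
Yang–Baxter being the case of `swap` itself; it passes to composites and tensor products. -/
theorem pt_whiskerLeft_swapPt {A B : QBialg} (f : A ⟶ B) :
    pt ◁ f ≫ swapPt B = swapPt A ≫ f ▷ pt := by
  induction f using homInd with
  | hid A => simp
  | hcomp f g hf hg => simp [hg, reassoc_of% hf]
  | htensor f g hf hg =>
    rename_i A B C D
    have hC : pt ◁ (f ▷ C) ≫ swapPt (B ⊗ C) = swapPt (A ⊗ C) ≫ (f ▷ C) ▷ pt := by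
      rw [swapPt_tensor, swapPt_tensor]
      calc _ = (α_ pt A C).inv ≫ (pt ◁ f ≫ swapPt B) ▷ C ≫ (α_ B pt C).hom ≫ B ◁ swapPt C ≫
            (α_ B C pt).inv := by monoidal
        _ = (α_ pt A C).inv ≫ swapPt A ▷ C ≫ (α_ A pt C).hom ≫
            (f ▷ (pt ⊗ C) ≫ B ◁ swapPt C) ≫ (α_ B C pt).inv := by rw [hf]; monoidal
        _ = _ := by rw [← whisker_exchange]; monoidal
    have hB : pt ◁ (B ◁ g) ≫ swapPt (B ⊗ D) = swapPt (B ⊗ C) ≫ (B ◁ g) ▷ pt := by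
      rw [swapPt_tensor, swapPt_tensor]
      calc _ = (α_ pt B C).inv ≫ ((pt ⊗ B) ◁ g ≫ swapPt B ▷ D) ≫ (α_ B pt D).hom ≫ B ◁ swapPt D ≫
            (α_ B D pt).inv := by monoidal
        _ = (α_ pt B C).inv ≫ swapPt B ▷ C ≫ (α_ B pt C).hom ≫
            B ◁ (pt ◁ g ≫ swapPt D) ≫ (α_ B D pt).inv := by rw [whisker_exchange]; monoidal
        _ = _ := by rw [hg]; monoidal
    rw [MonoidalCategory.tensorHom_def, whiskerLeft_comp, Category.assoc, hB, reassoc_of% hC,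
      comp_whiskerRight]
  | hmul =>
    rw [swapPt_tensor, swapPt_pt, mul_swap]
    simp
  | hunit =>
    rw [swapPt_pt, swapPt_one, ← cancel_epi (ρ_ pt).inv, unit_swap]
    simp
  | hcomul =>
    -- `swap_comul` solved for `pt ◁ comul`, using that `swap` is an involution.
    have h : pt ◁ comul = swap ≫ comul ▷ pt ≫ (α_ pt pt pt).hom ≫ pt ◁ swap ≫ (α_ pt pt pt).inv
      ≫ swap ▷ pt ≫ (α_ pt pt pt).hom := by
      rw [reassoc_of% swap_comul]
      simp [← whiskerLeft_comp_assoc, swap_swap, ← comp_whiskerRight_assoc]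
    rw [swapPt_tensor, swapPt_pt, h]
    simp [← whiskerLeft_comp_assoc, swap_swap, ← comp_whiskerRight_assoc]
  | hcounit =>
    rw [swapPt_pt, swapPt_one, ← cancel_mono (λ_ pt).hom]
    simp [swap_counit]
  | hswap =>
    rw [swapPt_tensor, swapPt_pt]
    have := yangBaxter
    simp only [Category.assoc, ← cancel_epi (α_ pt pt pt).hom]
    simp [this]

/-- The symmetry of two objects. -/
def braid (A B : QBialg) : A ⊗ B ⟶ B ⊗ A :=
  objRec (P := fun A => A ⊗ B ⟶ B ⊗ A) ((λ_ B).hom ≫ (ρ_ B).inv) (fun A c =>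
    (α_ pt A B).hom ≫ pt ◁ c ≫ (α_ pt B A).inv ≫ swapPt B ▷ A ≫ (α_ B pt A).hom) A

theorem braid_one (B : QBialg) : braid (𝟙_ QBialg) B = (λ_ B).hom ≫ (ρ_ B).inv := rfl

theorem braid_cons (A B : QBialg) : braid (pt ⊗ A) B =
   (α_ pt A B).hom ≫ pt ◁ braid A B ≫ (α_ pt B A).inv ≫ swapPt B ▷ A ≫ (α_ B pt A).hom := rfl

theorem braid_congr {A A' : QBialg} (h : A = A') (B : QBialg) :
    braid A B = eqToHom h ▷ B ≫ braid A' B ≫ B ◁ eqToHom h.symm := by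
  subst h
  simp

theorem braid_pt (B : QBialg) : braid pt B = swapPt B := by
  have h : braid pt B = (ρ_ pt).inv ▷ B ≫ braid (pt ⊗ 𝟙_ QBialg) B ≫ B ◁ (ρ_ pt).hom :=
    braid_congr (IsStrictMonoidal.tensor_unit pt).symm B
  rw [h, braid_cons, braid_one]
  monoidal

theorem braid_tensor_left (A B C : QBialg) : braid (A ⊗ B) C =
    (α_ A B C).hom ≫ A ◁ braid B C ≫ (α_ A C B).inv ≫ braid A C ▷ B ≫ (α_ C A B).hom := by
  induction A using objRec with
  | one =>
    have h : braid (𝟙_ QBialg ⊗ B) C = (λ_ B).hom ▷ C ≫ braid B C ≫ C ◁ (λ_ B).inv :=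
      braid_congr (IsStrictMonoidal.unit_tensor B) C
    rw [h, braid_one]
    monoidal
  | cons A ih =>
    have h : braid ((pt ⊗ A) ⊗ B) C =
        (α_ pt A B).hom ▷ C ≫ braid (pt ⊗ (A ⊗ B)) C ≫ C ◁ (α_ pt A B).inv :=
      braid_congr (IsStrictMonoidal.tensor_assoc pt A B) C
    rw [h, braid_cons, braid_cons, ih]
    monoidal

theorem whiskerLeft_braid (A : QBialg) {B C : QBialg} (f : B ⟶ C) :
    A ◁ f ≫ braid A C = braid A B ≫ f ▷ A := by
  induction A using objRec with
  | one => simp [braid_one]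
  | cons A ih =>
    rw [braid_cons, braid_cons]
    simp only [tensor_whiskerLeft, Category.assoc, Iso.inv_hom_id_assoc]
    rw [← whiskerLeft_comp_assoc, ih]
    have h := congrArg (fun k => k ▷ A) (pt_whiskerLeft_swapPt f)
    simp only [comp_whiskerRight] at h
    simp only [whiskerLeft_comp, Category.assoc, associator_inv_naturality_middle_assoc,
      whiskerRight_tensor, Iso.hom_inv_id_assoc, reassoc_of% h]

theorem swapPt_braid_pt (A : QBialg) : swapPt A ≫ braid A pt = 𝟙 (pt ⊗ A) := by
  induction A using objRec with
  | one => simp [swapPt_one, braid_one]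
  | cons A ih =>
    rw [swapPt_cons, braid_cons, swapPt_pt]
    simp only [Category.assoc, Iso.inv_hom_id_assoc]
    rw [← whiskerLeft_comp_assoc pt (swapPt A), ih]
    simp [← comp_whiskerRight_assoc, swap_swap]

/-- `braid` recurses on its first argument; this is the matching recursion on the second, so that
`braid A B` and `braid B A` can be unfolded together in `braid_braid`. -/
theorem braid_pt_tensor (A B : QBialg) : braid A (pt ⊗ B) =
    (α_ A pt B).inv ≫ braid A pt ▷ B ≫ (α_ pt A B).hom ≫ pt ◁ braid A B ≫ (α_ pt B A).inv := by
  induction A using objRec with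
  | one => rw [braid_one, braid_one, braid_one]; monoidal
  | cons A ih =>
    rw [braid_cons, braid_cons, braid_cons, ih, swapPt_cons, swapPt_pt]
    calc _ = (α_ pt A (pt ⊗ B)).hom ≫ pt ◁ ((α_ A pt B).inv ≫ braid A pt ▷ B ≫ (α_ pt A B).hom) ≫
          (α_ pt pt (A ⊗ B)).inv ≫ ((pt ⊗ pt) ◁ braid A B ≫ swap ▷ (B ⊗ A)) ≫
          (α_ pt pt (B ⊗ A)).hom ≫ pt ◁ ((α_ pt B A).inv ≫ swapPt B ▷ A ≫ (α_ B pt A).hom) ≫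
          (α_ pt B (pt ⊗ A)).inv := by monoidal
      _ = _ := by rw [whisker_exchange]; monoidal

theorem braid_braid (A B : QBialg) : braid A B ≫ braid B A = 𝟙 (A ⊗ B) := by
  induction A using objRec with
  | one =>
    induction B using objRec with
    | one => simp [braid_one, unitors_equal]
    | cons B ih =>
      rw [braid_one] at ih ⊢
      rw [braid_cons, swapPt_one]
      have : braid B (𝟙_ QBialg) = (ρ_ B).hom ≫ (λ_ B).inv := by
        rw [← cancel_epi ((λ_ B).hom ≫ (ρ_ B).inv), ih]; simp
      rw [this]
      monoidal
  | cons A ih =>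
    rw [braid_cons, braid_pt_tensor]
    simp only [Category.assoc, Iso.hom_inv_id_assoc]
    rw [← comp_whiskerRight_assoc, swapPt_braid_pt]
    simp only [id_whiskerRight, Category.id_comp, Iso.inv_hom_id_assoc]
    rw [← whiskerLeft_comp_assoc, ih]
    simp

/-- The symmetry as an isomorphism. -/
@[simps]
def braidIso (A B : QBialg) : A ⊗ B ≅ B ⊗ A where
  hom := braid A B
  inv := braid B A
  hom_inv_id := braid_braid A B
  inv_hom_id := braid_braid B A

/-- The inverse of `braid_tensor_left`, since `braid` is its own inverse. -/
theorem braid_tensor_right (A B C : QBialg) : braid A (B ⊗ C) =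
    (α_ A B C).inv ≫ braid A B ▷ C ≫ (α_ B A C).hom ≫ B ◁ braid A C ≫ (α_ B C A).inv := by
  have h := braid_tensor_left B C A
  have h' : (braidIso (B ⊗ C) A) = (α_ B C A) ≪≫ whiskerLeftIso B (braidIso C A) ≪≫
      (α_ B A C).symm ≪≫ whiskerRightIso (braidIso B A) C ≪≫ α_ A B C := by
    ext; simp [h]
  simpa using congrArg Iso.inv h'

instance : SymmetricCategory QBialg where
  braiding := braidIso
  braiding_naturality_right A _ _ f := whiskerLeft_braid A f
  -- Conjugation by the involution `braid` turns naturality in one variable into naturality in the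
  -- other.
  braiding_naturality_left {A B} f C := by
    rw [← cancel_mono (braidIso C B).hom, ← cancel_epi (braidIso C A).hom]
    simp [braid_braid, reassoc_of% (braid_braid C A), whiskerLeft_braid]
  hexagon_forward A B C := by simp [braid_tensor_right]
  hexagon_reverse A B C := by simp [braid_tensor_left]
  symmetry A B := braid_braid A B

theorem braiding_pt : (β_ pt pt).hom = swap := (braid_pt pt).trans swapPt_pt

end QBialg
end Bialg

/-! ### Interchange identities in braided and symmetric monoidal categories -/

/-- Interchanging the middle factors commutes with the braiding. -/
theorem tensorμ_comp_braiding_tensorHom_braiding {C : Type u} [Category.{v} C] [MonoidalCategory C]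
    [SymmetricCategory C] (A B : C) :
    tensorμ A A B B ≫ ((β_ A B).hom ⊗ₘ (β_ A B).hom) =
      (β_ (A ⊗ A) (B ⊗ B)).hom ≫ tensorμ B B A A := by
  dsimp only [tensorμ]
  symm
  calc
    _ = 𝟙 _ ⊗≫ A ◁ (β_ A B).hom ▷ B ⊗≫ (A ⊗ B) ◁ (β_ A B).hom ⊗≫ (β_ A B).hom ▷ (B ⊗ A) ⊗≫
        B ◁ ((β_ A B).hom ≫ (β_ B A).hom) ▷ A ⊗≫ 𝟙 _ := by
      rw [BraidedCategory.braiding_tensor_left_hom, BraidedCategory.braiding_tensor_right_hom]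
      monoidal
    _ = _ := by
      rw [SymmetricCategory.symmetry, MonoidalCategory.tensorHom_def']
      monoidal

/-- Interchanging the middle factors and discarding the outer ones. -/
theorem tensorμ_comp_tensorHom_discard {C : Type u} [Category.{v} C] [MonoidalCategory C]
    [BraidedCategory C] {A B : C} (a : A ⟶ 𝟙_ C) (b : B ⟶ 𝟙_ C) :
    tensorμ A A B B ≫ ((A ◁ b ≫ (ρ_ A).hom) ⊗ₘ (a ▷ B ≫ (λ_ B).hom)) =
      (A ◁ a ≫ (ρ_ A).hom) ⊗ₘ (b ▷ B ≫ (λ_ B).hom) := by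
  have h := tensorμ_natural (𝟙 A) a b (𝟙 B)
  -- Both interchanged factors are the unit, whose braiding with itself is the identity.
  have h' : tensorμ A (𝟙_ C) (𝟙_ C) B = 𝟙 _ := by
    rw [tensorμ, braiding_tensorUnit_left, ← unitors_inv_equal]
    simp
  rw [h', Category.comp_id] at h
  simp only [id_tensorHom, tensorHom_id] at h
  rw [← tensorHom_comp_tensorHom, ← reassoc_of% h, tensorHom_comp_tensorHom]

theorem tensorHom_toUnit_assoc {C : Type u} [Category.{v} C] [MonoidalCategory C] {A B D : C}
    (a : A ⟶ 𝟙_ C) (b : B ⟶ 𝟙_ C) (d : D ⟶ 𝟙_ C) :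
    (α_ A B D).hom ≫ (a ⊗ₘ (b ⊗ₘ d) ≫ (λ_ (𝟙_ C)).hom) ≫ (λ_ (𝟙_ C)).hom =
      ((a ⊗ₘ b) ≫ (λ_ (𝟙_ C)).hom ⊗ₘ d) ≫ (λ_ (𝟙_ C)).hom := by
  monoidal

/-- By naturality `a` and `b` can be applied before the interchange, which then involves units only
and reduces to coherence. It reduces the counit law of `A ⊗ B` to those of `A` and `B`. -/
theorem tensorHom_comp_tensorμ_discard_right {C : Type u} [Category.{v} C] [MonoidalCategory C]
    [BraidedCategory C] {A B : C} (dA : A ⟶ A ⊗ A) (dB : B ⟶ B ⊗ B) (a : A ⟶ 𝟙_ C)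
    (b : B ⟶ 𝟙_ C) :
    ((dA ⊗ₘ dB) ≫ tensorμ A A B B) ≫ (A ⊗ B) ◁ ((a ⊗ₘ b) ≫ (λ_ (𝟙_ C)).hom) ≫ (ρ_ (A ⊗ B)).hom =
      (dA ≫ A ◁ a ≫ (ρ_ A).hom) ⊗ₘ (dB ≫ B ◁ b ≫ (ρ_ B).hom) := by
  have h := tensorμ_natural (𝟙 A) a (𝟙 B) b
  simp only [id_tensorHom, whiskerLeft_id] at h
  rw [whiskerLeft_comp, Category.assoc, Category.assoc, ← reassoc_of% h, ← rightUnitor_monoidal,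
    tensorHom_comp_tensorHom, tensorHom_comp_tensorHom]

theorem tensorHom_comp_tensorμ_discard_left {C : Type u} [Category.{v} C] [MonoidalCategory C]
    [BraidedCategory C] {A B : C} (dA : A ⟶ A ⊗ A) (dB : B ⟶ B ⊗ B) (a : A ⟶ 𝟙_ C)
    (b : B ⟶ 𝟙_ C) :
    ((dA ⊗ₘ dB) ≫ tensorμ A A B B) ≫ ((a ⊗ₘ b) ≫ (λ_ (𝟙_ C)).hom) ▷ (A ⊗ B) ≫ (λ_ (A ⊗ B)).hom =
      (dA ≫ a ▷ A ≫ (λ_ A).hom) ⊗ₘ (dB ≫ b ▷ B ≫ (λ_ B).hom) := by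
  have h := tensorμ_natural a (𝟙 A) b (𝟙 B)
  simp only [tensorHom_id, id_whiskerRight] at h
  rw [comp_whiskerRight, Category.assoc, Category.assoc, ← reassoc_of% h, ← leftUnitor_monoidal,
    tensorHom_comp_tensorHom, tensorHom_comp_tensorHom]

/-! ### Natural comonoid structure on every object -/

namespace Bialg
namespace QBialg

/-- The counit of an arbitrary object. -/
def discard : ∀ A : QBialg, A ⟶ 𝟙_ QBialg :=
  objRec (𝟙 _) fun _ d => (counit ⊗ₘ d) ≫ (λ_ _).hom

theorem discard_one : discard (𝟙_ QBialg) = 𝟙 _ := rfl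

theorem discard_cons (A : QBialg) : discard (pt ⊗ A) = (counit ⊗ₘ discard A) ≫ (λ_ _).hom := rfl

theorem discard_congr {A B : QBialg} (h : A = B) : discard A = eqToHom h ≫ discard B := by
  subst h
  simp

theorem discard_pt : discard pt = counit := by
  have h : discard pt = (ρ_ pt).inv ≫ discard (pt ⊗ 𝟙_ QBialg) :=
    discard_congr (IsStrictMonoidal.tensor_unit pt).symm
  rw [h, discard_cons, discard_one]
  simp [unitors_equal]

theorem discard_tensor (A B : QBialg) :
    discard (A ⊗ B) = (discard A ⊗ₘ discard B) ≫ (λ_ _).hom := by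
  induction A using objRec with
  | one =>
    have h : discard (𝟙_ QBialg ⊗ B) = (λ_ B).hom ≫ discard B :=
      discard_congr (IsStrictMonoidal.unit_tensor B)
    rw [h, discard_one]
    simp
  | cons A ih =>
    have h : discard ((pt ⊗ A) ⊗ B) = (α_ pt A B).hom ≫ discard (pt ⊗ (A ⊗ B)) :=
      discard_congr (IsStrictMonoidal.tensor_assoc pt A B)
    rw [h, discard_cons, discard_cons, ih, tensorHom_toUnit_assoc]

theorem comp_discard {A B : QBialg} (f : A ⟶ B) : f ≫ discard B = discard A := by
  induction f using homInd with
  | hid A => simp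
  | hcomp f g hf hg => simp [hf, hg]
  | htensor f g hf hg => simp [discard_tensor, hf, hg]
  | hmul => rw [discard_tensor, discard_pt, mul_counit]
  | hunit => rw [discard_pt, discard_one, unit_counit]
  | hcomul =>
    rw [discard_tensor, discard_pt]
    have := comul_counit =≫ counit
    simpa [unitors_equal, MonoidalCategory.tensorHom_def'] using this
  | hcounit => simp [discard_one, discard_pt]
  | hswap =>
    rw [discard_tensor, discard_pt, ← braiding_pt, ← BraidedCategory.braiding_naturality_assoc,
      braiding_leftUnitor, unitors_equal]

/-- The diagonal of an arbitrary object. -/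
def diag : ∀ A : QBialg, A ⟶ A ⊗ A :=
  objRec (λ_ _).inv fun A d => (comul ⊗ₘ d) ≫ tensorμ pt pt A A

theorem diag_one : diag (𝟙_ QBialg) = (λ_ _).inv := rfl

theorem diag_cons (A : QBialg) : diag (pt ⊗ A) = (comul ⊗ₘ diag A) ≫ tensorμ pt pt A A := rfl

theorem diag_congr {A B : QBialg} (h : A = B) :
    diag A = eqToHom h ≫ diag B ≫ (eqToHom h.symm ⊗ₘ eqToHom h.symm) := by
  subst h
  simp

theorem diag_pt : diag pt = comul := by
  have h : diag pt = (ρ_ pt).inv ≫ diag (pt ⊗ 𝟙_ QBialg) ≫ ((ρ_ pt).hom ⊗ₘ (ρ_ pt).hom) :=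
    diag_congr (IsStrictMonoidal.tensor_unit pt).symm
  rw [h, diag_cons, diag_one, MonoidalCategory.tensorHom_def]
  simp only [Category.assoc]
  rw [← tensor_right_unitality]
  simp

/-- The unit and associativity coherences of `tensorμ` handle the empty word and the addition of a
letter. -/
theorem diag_tensor (A B : QBialg) :
    diag (A ⊗ B) = (diag A ⊗ₘ diag B) ≫ tensorμ A A B B := by
  induction A using objRec with
  | one =>
    have h : diag (𝟙_ QBialg ⊗ B) = (λ_ B).hom ≫ diag B ≫ ((λ_ B).inv ⊗ₘ (λ_ B).inv) :=
      diag_congr (IsStrictMonoidal.unit_tensor B)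
    rw [h, diag_one, MonoidalCategory.tensorHom_def' _ (diag B), Category.assoc,
      ← leftUnitor_naturality_assoc, tensor_left_unitality]
    simp
  | cons A ih =>
    have h : diag ((pt ⊗ A) ⊗ B) = (α_ pt A B).hom ≫ diag (pt ⊗ (A ⊗ B)) ≫
        ((α_ pt A B).inv ⊗ₘ (α_ pt A B).inv) :=
      diag_congr (IsStrictMonoidal.tensor_assoc pt A B)
    rw [h, diag_cons, diag_cons, ih, ← cancel_mono ((α_ pt A B).hom ⊗ₘ (α_ pt A B).hom)]
    have e : ((comul ⊗ₘ diag A) ≫ tensorμ pt pt A A ⊗ₘ diag B) =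
        ((comul ⊗ₘ diag A) ⊗ₘ diag B) ≫ tensorμ pt pt A A ▷ _ := by
      rw [← tensorHom_id, tensorHom_comp_tensorHom, Category.comp_id]
    rw [e]
    simp only [Category.assoc]
    rw [tensor_associativity, associator_naturality_assoc, ← id_tensorHom,
      tensorHom_comp_tensorHom_assoc, Category.comp_id, tensorHom_comp_tensorHom]
    simp

/-- Coassociativity presents the fourfold copy with a `comul` producing the two middle factors;
cocommutativity then absorbs their interchange. -/
theorem comul_comul_tensorμ :
    comul ≫ (comul ⊗ₘ comul) ≫ tensorμ pt pt pt pt = comul ≫ (comul ⊗ₘ comul) := by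
  have h : comul ≫ (comul ⊗ₘ comul) =
      comul ≫ pt ◁ (comul ≫ comul ▷ pt ≫ (α_ pt pt pt).hom) ≫ (α_ pt pt (pt ⊗ pt)).inv := by
    rw [MonoidalCategory.tensorHom_def, reassoc_of% comul_coassoc]
    have h := congrArg (fun k => comul ≫ pt ◁ k) (comul_coassoc =≫ (α_ pt pt pt).hom)
    simp only [Category.assoc, Iso.inv_hom_id, Category.comp_id, whiskerLeft_comp] at h
    simp [reassoc_of% h]
  rw [← Category.assoc, h, tensorμ, braiding_pt]
  simp only [Category.assoc, Iso.inv_hom_id_assoc, ← whiskerLeft_comp_assoc, Iso.hom_inv_id_assoc]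
  rw [← comp_whiskerRight_assoc, comul_swap]

/-- The case of `mul` is the bialgebra relation, and that of `comul` needs both coassociativity and
cocommutativity. This naturality gives uniqueness of pairings in the cartesian structure. -/
theorem comp_diag {A B : QBialg} (f : A ⟶ B) : f ≫ diag B = diag A ≫ (f ⊗ₘ f) := by
  induction f using homInd with
  | hid A => simp
  | hcomp f g hf hg => simp [hg, reassoc_of% hf]
  | htensor f g hf hg =>
    rw [diag_tensor, diag_tensor, Category.assoc, ← tensorμ_natural,
      tensorHom_comp_tensorHom_assoc, tensorHom_comp_tensorHom_assoc, hf, hg]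
  | hmul => simp [diag_tensor, diag_pt, mul_comul, tensorμ, braiding_pt]
  | hunit => rw [diag_pt, diag_one, unit_comul]
  | hcomul => rw [diag_tensor, diag_pt, comul_comul_tensorμ]
  | hcounit =>
    rw [diag_pt, diag_one]
    have h := comul_counit =≫ counit
    rw [← cancel_mono (λ_ _).hom, Category.assoc, Category.assoc, Iso.inv_hom_id]
    simpa [unitors_equal, MonoidalCategory.tensorHom_def'] using h.symm
  | hswap =>
    rw [diag_tensor, diag_pt, ← braiding_pt, Category.assoc,
      tensorμ_comp_braiding_tensorHom_braiding, BraidedCategory.braiding_naturality_assoc]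

/-- The first projection. -/
def proj₁ (A B : QBialg) : A ⊗ B ⟶ A := A ◁ discard B ≫ (ρ_ A).hom

/-- The second projection. -/
def proj₂ (A B : QBialg) : A ⊗ B ⟶ B := discard A ▷ B ≫ (λ_ B).hom

theorem diag_proj₁ (A : QBialg) : diag A ≫ proj₁ A A = 𝟙 A := by
  rw [proj₁]
  induction A using objRec with
  | one => rw [diag_one, discard_one, ← unitors_equal]; simp
  | cons A ih =>
    rw [diag_cons, discard_cons, tensorHom_comp_tensorμ_discard_right, ih, comul_counit,
      id_tensorHom_id]

theorem diag_proj₂ (A : QBialg) : diag A ≫ proj₂ A A = 𝟙 A := by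
  rw [proj₂]
  induction A using objRec with
  | one => rw [diag_one, discard_one]; simp
  | cons A ih =>
    rw [diag_cons, discard_cons, tensorHom_comp_tensorμ_discard_left, ih, counit_comul,
      id_tensorHom_id]

theorem diag_proj (A B : QBialg) : diag (A ⊗ B) ≫ (proj₁ A B ⊗ₘ proj₂ A B) = 𝟙 (A ⊗ B) := by
  rw [diag_tensor, Category.assoc, proj₁, proj₂, tensorμ_comp_tensorHom_discard,
    tensorHom_comp_tensorHom, ← proj₁, ← proj₂, diag_proj₁, diag_proj₂, id_tensorHom_id]

end QBialg
-- Soundness of the interpretation by relations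
/-- The interpretation of the generators as relations. -/
def genEval : Gen → ℕ → ℕ → Bool
  | .mu, i, j => decide (i < 2) && decide (j = 0)
  | .eta, _, _ => false
  | .delta, i, j => decide (i = 0) && decide (j < 2)
  | .eps, _, _ => false
  | .gamma, i, j => decide (i + j = 1)

/-- The interpretation of terms as relations. -/
def termEval {A B : FreeMonoid sig.Ob} : MonSignature.Term sig A B → ℕ → ℕ → Bool
  | .gen g => genEval g
  | .id A => fun i j => decide (i = j) && decide (i < A.length)
  | .comp (B := B) f g => fun i j =>
      (List.range B.length).any fun k => termEval f i k && termEval g k j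
  | .tensor (A := A) (B := B) f g => fun i j => termEval f i j ||
      (decide (A.length ≤ i) && decide (B.length ≤ j) &&
        termEval g (i - A.length) (j - B.length))

theorem lt_of_genEval {g : Gen} {i j : ℕ} (h : genEval g i j) :
    i < (sig.s g).length ∧ j < (sig.t g).length := by
  cases g <;> simp [genEval] at h <;> simp [sig, FreeMonoid.length_mul] <;> omega

/-- Relations live on all of `ℕ`, supported below the lengths. This bound removes the range
restriction on the intermediate index of a composite. -/
theorem lt_of_termEval {A B : FreeMonoid sig.Ob} (t : MonSignature.Term sig A B) {i j : ℕ}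
    (h : termEval t i j) :
    i < A.length ∧ j < B.length := by
  induction t generalizing i j with
  | gen g => exact lt_of_genEval h
  | id A => simp [termEval] at h; omega
  | comp f g hf hg =>
    simp only [termEval, List.any_eq_true, Bool.and_eq_true] at h
    obtain ⟨k, -, h1, h2⟩ := h
    exact ⟨(hf h1).1, (hg h2).2⟩
  | tensor f g hf hg =>
    simp only [termEval, Bool.or_eq_true, Bool.and_eq_true, decide_eq_true_eq] at h
    rw [FreeMonoid.length_mul, FreeMonoid.length_mul]
    rcases h with h | ⟨⟨h1, h2⟩, h⟩
    · have := hf h; omega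
    · have := hg h; omega

theorem termEval_comp {A B C : FreeMonoid sig.Ob} (f : MonSignature.Term sig A B)
    (g : MonSignature.Term sig B C) (i j : ℕ) :
    termEval (f.comp g) i j ↔ ∃ k, termEval f i k ∧ termEval g k j := by
  simp only [termEval, List.any_eq_true, Bool.and_eq_true, List.mem_range]
  exact ⟨fun ⟨k, _, h⟩ => ⟨k, h⟩, fun ⟨k, h⟩ => ⟨k, (lt_of_termEval f h.1).2, h⟩⟩

theorem termEval_tensor {A B C D : FreeMonoid sig.Ob} (f : MonSignature.Term sig A B)
    (g : MonSignature.Term sig C D) (i j : ℕ) :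
    termEval (f.tensor g) i j ↔ termEval f i j ∨
      A.length ≤ i ∧ B.length ≤ j ∧ termEval g (i - A.length) (j - B.length) := by
  simp [termEval, and_assoc]

theorem termEval_id (A : FreeMonoid sig.Ob) (i j : ℕ) :
    termEval (.id A) i j ↔ i = j ∧ i < A.length := by
  simp [termEval]

/-- The benefit of relations on `ℕ` instead of `Fin`: transport along equalities of objects changes
nothing. -/
theorem termEval_cast {A B A' B' : FreeMonoid sig.Ob} (hA : A = A') (hB : B = B')
    (f : MonSignature.Term sig A B) : termEval (f.cast hA hB) = termEval f := by
  subst hA hB; rfl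

theorem termEval_eq_of_eqv {A B : FreeMonoid sig.Ob} {f g : MonSignature.Term sig A B}
    (h : f.Eqv g) :
    termEval f = termEval g := by
  induction h with
  | refl f => rfl
  | symm _ h => exact h.symm
  | trans _ _ h h' => exact h.trans h'
  | comp_congr _ _ h h' => simp [termEval, h, h']
  | tensor_congr _ _ h h' => simp [termEval, h, h']
  | id_comp f =>
    refine funext₂ fun i j => Bool.eq_iff_iff.2 ?_
    have := @lt_of_termEval _ _ f i j
    simp only [termEval_comp, termEval_id]
    grind
  | comp_id f =>
    refine funext₂ fun i j => Bool.eq_iff_iff.2 ?_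
    have := @lt_of_termEval _ _ f i j
    simp only [termEval_comp, termEval_id]
    grind
  | comp_assoc f g h =>
    refine funext₂ fun i j => Bool.eq_iff_iff.2 ?_
    simp only [termEval_comp]
    grind
  | id_tensor_id A B =>
    refine funext₂ fun i j => Bool.eq_iff_iff.2 ?_
    simp only [termEval_tensor, termEval_id, FreeMonoid.length_mul]
    omega
  | tensor_comp_tensor f₁ f₂ g₁ g₂ =>
    refine funext₂ fun i j => Bool.eq_iff_iff.2 ?_
    have h₁ (i j) := @lt_of_termEval _ _ f₁ i j
    have h₁' (i j) := @lt_of_termEval _ _ g₁ i j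
    simp only [termEval_comp, termEval_tensor]
    constructor
    · rintro ⟨k, h | ⟨ha, hb, h⟩, h' | ⟨ha', hb', h'⟩⟩
      · exact .inl ⟨k, h, h'⟩
      · have := h₁ _ _ h; omega
      · have := h₁' _ _ h'; omega
      · exact .inr ⟨ha, hb', _, h, h'⟩
    · rintro (⟨k, h, h'⟩ | ⟨ha, hb, k, h, h'⟩)
      · exact ⟨k, .inl h, .inl h'⟩
      · exact ⟨_ + k, .inr ⟨ha, Nat.le_add_right _ _, by simpa using h⟩,
          .inr ⟨Nat.le_add_right _ _, hb, by simpa using h'⟩⟩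
  | tensor_assoc f₁ f₂ f₃ =>
    rw [termEval_cast]
    refine funext₂ fun i j => Bool.eq_iff_iff.2 ?_
    simp only [termEval_tensor, FreeMonoid.length_mul]
    have e (a b c : ℕ) : a - (b + c) = a - b - c := by omega
    rw [e, e]
    grind
  | unit_tensor f =>
    rw [termEval_cast]
    refine funext₂ fun i j => Bool.eq_iff_iff.2 ?_
    simp [termEval_tensor, termEval_id]
  | tensor_unit f =>
    rw [termEval_cast]
    refine funext₂ fun i j => Bool.eq_iff_iff.2 ?_
    simp [termEval_tensor, termEval_id]

/-- The interpretation of the morphisms of the free monoidal category as relations. -/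
def freeEval {A B : sig.Free} (f : A ⟶ B) : ℕ → ℕ → Bool :=
  Quotient.lift termEval (fun _ _ h => termEval_eq_of_eqv h) f

theorem lt_of_freeEval {A B : sig.Free} (f : A ⟶ B) {i j : ℕ} (h : freeEval f i j) :
    i < FreeMonoid.length (α := Unit) A ∧ j < FreeMonoid.length (α := Unit) B := by
  obtain ⟨t⟩ := f
  exact lt_of_termEval t h

theorem freeEval_comp {A B C : sig.Free} (f : A ⟶ B) (g : B ⟶ C) (i j : ℕ) :
    freeEval (f ≫ g) i j ↔ ∃ k, freeEval f i k ∧ freeEval g k j := by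
  obtain ⟨f⟩ := f
  obtain ⟨g⟩ := g
  exact termEval_comp f g i j

theorem freeEval_tensor {A B C D : sig.Free} (f : A ⟶ B) (g : C ⟶ D) (i j : ℕ) :
    freeEval (f ⊗ₘ g) i j ↔ freeEval f i j ∨
      FreeMonoid.length (α := Unit) A ≤ i ∧ FreeMonoid.length (α := Unit) B ≤ j ∧
        freeEval g (i - FreeMonoid.length (α := Unit) A) (j - FreeMonoid.length (α := Unit) B) := by
  obtain ⟨f⟩ := f
  obtain ⟨g⟩ := g
  exact termEval_tensor f g i j

/-- Reduces each relation of the theory to a finite Boolean check, which `decide` can carry out. -/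
theorem freeEval_eq_of_forall_lt {A B : sig.Free} {f g : A ⟶ B}
    (h : ∀ i < FreeMonoid.length (α := Unit) A, ∀ j < FreeMonoid.length (α := Unit) B,
      freeEval f i j = freeEval g i j) : freeEval f = freeEval g := by
  ext i j
  have h₁ := @lt_of_freeEval _ _ f i j
  have h₂ := @lt_of_freeEval _ _ g i j
  grind

theorem freeEval_rel (e : RelName) : freeEval (rel e).lhs = freeEval (rel e).rhs := by
  apply freeEval_eq_of_forall_lt
  cases e <;> decide +kernel

theorem freeEval_eq_of_cong {A B : qualitativeTheory.toMonSignature.Free} {f g : A ⟶ B}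
    (h : qualitativeTheory.Cong f g) :
    freeEval (A := A) (B := B) f = freeEval (A := A) (B := B) g := by
  induction h with
  | of e =>
    cases e with
    | none =>
      apply freeEval_eq_of_forall_lt (f := δ ≫ μ) (g := 𝟙 X)
      decide +kernel
    | some e => exact freeEval_rel e
  | refl f => rfl
  | symm _ h => exact h.symm
  | trans _ _ h h' => exact h.trans h'
  | comp_congr _ _ h h' =>
    refine funext₂ fun i j => Bool.eq_iff_iff.2 ?_
    exact (freeEval_comp _ _ i j).trans ((by rw [h, h'] : _ ↔ _).trans (freeEval_comp _ _ i j).symm)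
  | tensor_congr _ _ h h' =>
    refine funext₂ fun i j => Bool.eq_iff_iff.2 ?_
    exact (freeEval_tensor _ _ i j).trans
      ((by rw [h, h'] : _ ↔ _).trans (freeEval_tensor _ _ i j).symm)

/-! ### Evaluation of morphisms and the cartesian structure -/

namespace QBialg

/-- The number of factors of an object. -/
def len (A : QBialg) : ℕ := FreeMonoid.length (α := Unit) A

theorem len_tensor (A B : QBialg) : len (A ⊗ B) = len A + len B :=
  FreeMonoid.length_mul _ _

theorem len_pt : len pt = 1 := rfl

theorem len_one : len (𝟙_ QBialg) = 0 := rfl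

/-- The relation between natural numbers underlying a morphism. -/
def Eval {A B : QBialg} (f : A ⟶ B) (i j : ℕ) : Prop :=
  Quotient.lift freeEval (fun _ _ h => freeEval_eq_of_cong h) f i j = true

theorem Eval.lt_left {A B : QBialg} {f : A ⟶ B} {i j : ℕ} (h : Eval f i j) : i < len A := by
  obtain ⟨f⟩ := f
  exact (lt_of_freeEval f h).1

theorem Eval.lt_right {A B : QBialg} {f : A ⟶ B} {i j : ℕ} (h : Eval f i j) : j < len B := by
  obtain ⟨f⟩ := f
  exact (lt_of_freeEval f h).2

theorem eval_comp {A B C : QBialg} (f : A ⟶ B) (g : B ⟶ C) (i j : ℕ) :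
    Eval (f ≫ g) i j ↔ ∃ k, Eval f i k ∧ Eval g k j := by
  obtain ⟨f⟩ := f
  obtain ⟨g⟩ := g
  exact freeEval_comp f g i j

theorem eval_tensor {A B C D : QBialg} (f : A ⟶ B) (g : C ⟶ D) (i j : ℕ) :
    Eval (f ⊗ₘ g) i j ↔
      Eval f i j ∨ len A ≤ i ∧ len B ≤ j ∧ Eval g (i - len A) (j - len B) := by
  obtain ⟨f⟩ := f
  obtain ⟨g⟩ := g
  exact freeEval_tensor f g i j

theorem eval_id (A : QBialg) (i j : ℕ) : Eval (𝟙 A) i j ↔ i = j ∧ i < len A :=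
  termEval_id A i j

theorem eval_eqToHom {A B : QBialg} (h : A = B) (i j : ℕ) :
    Eval (eqToHom h) i j ↔ i = j ∧ i < len A := by
  subst h
  exact eval_id A i j

theorem eval_mul (i j : ℕ) : Eval mul i j ↔ i < 2 ∧ j = 0 := by
  show genEval .mu i j = true ↔ _
  simp [genEval]

theorem not_eval_toUnit {A : QBialg} (f : A ⟶ 𝟙_ QBialg) (i j : ℕ) : ¬ Eval f i j :=
  fun h => Nat.not_lt_zero _ h.lt_right

theorem eval_proj₁ (A B : QBialg) (i j : ℕ) : Eval (proj₁ A B) i j ↔ i = j ∧ i < len A := by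
  have h (i j : ℕ) : Eval (ρ_ A).hom i j ↔ i = j ∧ i < len (A ⊗ 𝟙_ QBialg) :=
    eval_eqToHom (IsStrictMonoidal.tensor_unit A) i j
  simp only [proj₁, eval_comp, ← id_tensorHom, eval_tensor, h, not_eval_toUnit, eval_id,
    len_tensor, len_one]
  grind

theorem eval_proj₂ (A B : QBialg) (i j : ℕ) :
    Eval (proj₂ A B) i j ↔ i = len A + j ∧ j < len B := by
  have h (i j : ℕ) : Eval (λ_ B).hom i j ↔ i = j ∧ i < len (𝟙_ QBialg ⊗ B) :=
    eval_eqToHom (IsStrictMonoidal.unit_tensor B) i j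
  simp only [proj₂, eval_comp, ← tensorHom_id, eval_tensor, h, not_eval_toUnit, eval_id,
    len_tensor, len_one]
  grind

theorem tensorHom_proj₁ {A B C D : QBialg} (f : A ⟶ B) (g : C ⟶ D) :
    (f ⊗ₘ g) ≫ proj₁ B D = proj₁ A C ≫ f := by
  rw [proj₁, proj₁, ← id_tensorHom, tensorHom_comp_tensorHom_assoc, comp_discard,
    Category.comp_id, Category.assoc, ← rightUnitor_naturality, MonoidalCategory.tensorHom_def',
    Category.assoc]

theorem tensorHom_proj₂ {A B C D : QBialg} (f : A ⟶ B) (g : C ⟶ D) :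
    (f ⊗ₘ g) ≫ proj₂ B D = proj₂ A C ≫ g := by
  rw [proj₂, proj₂, ← tensorHom_id, tensorHom_comp_tensorHom_assoc, comp_discard,
    Category.comp_id, Category.assoc, ← leftUnitor_naturality, MonoidalCategory.tensorHom_def,
    Category.assoc]

theorem diag_tensorHom_proj₁ {A B C : QBialg} (f : A ⟶ B) (g : A ⟶ C) :
    (diag A ≫ (f ⊗ₘ g)) ≫ proj₁ B C = f := by
  rw [Category.assoc, tensorHom_proj₁, reassoc_of% (diag_proj₁ A)]

theorem diag_tensorHom_proj₂ {A B C : QBialg} (f : A ⟶ B) (g : A ⟶ C) :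
    (diag A ≫ (f ⊗ₘ g)) ≫ proj₂ B C = g := by
  rw [Category.assoc, tensorHom_proj₂, reassoc_of% (diag_proj₂ A)]

/-- Fox's theorem. Naturality of `discard` makes the unit terminal; naturality of `diag` together
with `diag_proj` shows that a morphism into `A ⊗ B` is recovered from its projections. -/
instance : CartesianMonoidalCategory QBialg where
  isTerminalTensorUnit := Limits.IsTerminal.ofUniqueHom discard fun A f => by
    rw [← comp_discard f, discard_one, Category.comp_id]
  fst := proj₁
  snd := proj₂
  fst_def _ _ := rfl
  snd_def _ _ := rfl
  tensorProductIsBinaryProduct A B :=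
    Limits.BinaryFan.isLimitMk (fun s => diag s.pt ≫ (s.fst ⊗ₘ s.snd))
      (fun s => diag_tensorHom_proj₁ s.fst s.snd) (fun s => diag_tensorHom_proj₂ s.fst s.snd)
      (fun s m h₁ h₂ => by
        rw [← h₁, ← h₂, ← tensorHom_comp_tensorHom, ← reassoc_of% comp_diag, diag_proj,
          Category.comp_id])

open CartesianMonoidalCategory

theorem eval_fst (A B : QBialg) (i j : ℕ) : Eval (fst A B) i j ↔ i = j ∧ i < len A :=
  eval_proj₁ A B i j

theorem eval_snd (A B : QBialg) (i j : ℕ) :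
    Eval (snd A B) i j ↔ i = len A + j ∧ j < len B :=
  eval_proj₂ A B i j

theorem eval_snd_comp {A B : QBialg} (f : A ⟶ B) (i j : ℕ) :
    Eval (snd pt A ≫ f) i j ↔ 1 ≤ i ∧ Eval f (i - 1) j := by
  simp only [eval_comp, eval_snd, len_pt]
  constructor
  · rintro ⟨k, ⟨rfl, -⟩, hk⟩
    exact ⟨by omega, by simpa using hk⟩
  · rintro ⟨hi, hk⟩
    exact ⟨i - 1, ⟨by omega, hk.lt_left⟩, hk⟩

/-- `f` and `g` are the projections of `lift f g`, and evaluating a projection only restricts or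
shifts indices. -/
theorem eval_lift {A B C : QBialg} (f : A ⟶ B) (g : A ⟶ C) (i j : ℕ) :
    Eval (lift f g) i j ↔ Eval f i j ∨ len B ≤ j ∧ Eval g i (j - len B) := by
  have hf : Eval f i j ↔ Eval (lift f g ≫ fst B C) i j := by rw [lift_fst]
  have hg : Eval g i (j - len B) ↔ Eval (lift f g ≫ snd B C) i (j - len B) := by rw [lift_snd]
  have h := @Eval.lt_right _ _ (lift f g) i j
  rw [len_tensor] at h
  simp only [hf, hg, eval_comp, eval_fst, eval_snd]
  constructor
  · intro hl
    by_cases hj : j < len B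
    · exact .inl ⟨j, hl, rfl, hj⟩
    · exact .inr ⟨by omega, j, hl, by omega, by have := h hl; omega⟩
  · rintro (⟨k, hk, rfl, -⟩ | ⟨hj, k, hk, hk', -⟩)
    · exact hk
    · rwa [show j = k by omega]

instance : MonObj pt where
  one := unit
  mul := mul
  one_mul := by
    rw [← cancel_epi (λ_ pt).inv, unit_mul, Iso.inv_hom_id]
  mul_one := by
    rw [← cancel_epi (ρ_ pt).inv, mul_unit, Iso.inv_hom_id]
  mul_assoc := mul_assoc

instance : IsCommMonObj pt where
  mul_comm := by
    rw [braiding_pt]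
    exact swap_mul

open scoped MonObj

theorem lift_id_id : lift (𝟙 pt) (𝟙 pt) = comul := by
  rw [← diag_pt]
  apply CartesianMonoidalCategory.hom_ext
  · rw [lift_fst]; exact (diag_proj₁ pt).symm
  · rw [lift_snd]; exact (diag_proj₂ pt).symm

/-- Qualitativity enters here: `f * f` is `f` followed by `comul ≫ mul`. -/
theorem hom_mul_self {A : QBialg} (f : A ⟶ pt) : f * f = f := by
  have h : lift f f = f ≫ comul := by rw [← lift_id_id, comp_lift, Category.comp_id]
  rw [Hom.mul_def, h, Category.assoc]
  exact (f ≫= comul_mul).trans (Category.comp_id f)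

theorem eval_hom_mul {A : QBialg} (f g : A ⟶ pt) (i j : ℕ) :
    Eval (f * g) i j ↔ Eval f i j ∨ Eval g i j := by
  have hf := @Eval.lt_right _ _ f i
  have hg := @Eval.lt_right _ _ g i
  have hfg : Eval (f * g) i j ↔ ∃ k, Eval (lift f g) i k ∧ Eval mul k j := eval_comp _ _ i j
  simp only [len_pt] at hf hg
  simp only [hfg, eval_lift, eval_mul, len_pt]
  constructor
  · rintro ⟨k, h | ⟨h1, h⟩, h', rfl⟩
    · have := hf h; exact .inl (by rwa [show k = 0 by omega] at h)
    · have := hg h; exact .inr (by rwa [show k - 1 = 0 by omega] at h)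
  · rintro (h | h)
    · have := hf h; exact ⟨j, .inl h, by omega, by omega⟩
    · have := hg h; exact ⟨j + 1, .inr ⟨by omega, by simpa using h⟩, by omega, by omega⟩

/-! ### Normal forms as joins of coordinate projections -/

/-- The joins of coordinate projections. -/
def Col : ∀ A : QBialg, Set (A ⟶ pt) :=
  objRec {1} fun A c => {f | ∃ g ∈ c, f = snd pt A ≫ g ∨ f = fst pt A * (snd pt A ≫ g)}

theorem mem_col_one {f : 𝟙_ QBialg ⟶ pt} : f ∈ Col (𝟙_ QBialg) ↔ f = 1 := Iff.rfl

theorem mem_col_cons {A : QBialg} {f : pt ⊗ A ⟶ pt} : f ∈ Col (pt ⊗ A) ↔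
    ∃ g ∈ Col A, f = snd pt A ≫ g ∨ f = fst pt A * (snd pt A ≫ g) := Iff.rfl

theorem one_mem_col (A : QBialg) : 1 ∈ Col A := by
  induction A using objRec with
  | one => exact mem_col_one.2 rfl
  | cons A ih => exact mem_col_cons.2 ⟨1, ih, .inl (MonObj.comp_one _).symm⟩

theorem mul_mem_col {A : QBialg} {f g : A ⟶ pt} (hf : f ∈ Col A) (hg : g ∈ Col A) :
    f * g ∈ Col A := by
  induction A using objRec with
  | one =>
    rw [mem_col_one] at *
    rw [hf, hg, _root_.mul_one]
  | cons A ih =>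
    rw [mem_col_cons] at *
    obtain ⟨f', hf', hf⟩ := hf
    obtain ⟨g', hg', hg⟩ := hg
    refine ⟨f' * g', ih hf' hg', ?_⟩
    rw [MonObj.comp_mul]
    rcases hf with rfl | rfl <;> rcases hg with rfl | rfl
    · exact .inl rfl
    · exact .inr (mul_left_comm _ _ _)
    · exact .inr (_root_.mul_assoc _ _ _)
    · refine .inr ?_
      -- Idempotence merges the two copies of the head projection.
      rw [mul_mul_mul_comm, hom_mul_self]

/-- In a normal form, the value at `0` tells whether the head projection occurs, and the values at
`i + 1` determine the tail. -/
theorem col_ext {A : QBialg} {f g : A ⟶ pt} (hf : f ∈ Col A) (hg : g ∈ Col A)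
    (h : ∀ i, Eval f i 0 ↔ Eval g i 0) : f = g := by
  induction A using objRec with
  | one =>
    rw [mem_col_one] at *
    rw [hf, hg]
  | cons A ih =>
    rw [mem_col_cons] at *
    obtain ⟨f', hf', hf⟩ := hf
    obtain ⟨g', hg', hg⟩ := hg
    have hr (k : A ⟶ pt) (i : ℕ) : Eval (fst pt A * (snd pt A ≫ k)) i 0 ↔
        i = 0 ∨ 1 ≤ i ∧ Eval k (i - 1) 0 := by
      rw [eval_hom_mul, eval_snd_comp, eval_fst, len_pt, Nat.lt_one_iff, and_self]
    have e : f' = g' := by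
      refine ih hf' hg' fun i => ?_
      have := h (i + 1)
      rcases hf with rfl | rfl <;> rcases hg with rfl | rfl <;> simpa [eval_snd_comp, hr] using this
    subst e
    have := h 0
    rcases hf with rfl | rfl <;> rcases hg with rfl | rfl
    · rfl
    · simp [eval_snd_comp, hr] at this
    · simp [eval_snd_comp, hr] at this
    · rfl

/-- The morphisms all of whose components are joins of coordinate projections. -/
def Cols (Z : QBialg) : ∀ A : QBialg, Set (Z ⟶ A) :=
  objRec Set.univ fun A c => {f | f ≫ fst pt A ∈ Col Z ∧ f ≫ snd pt A ∈ c}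

theorem mem_cols_cons {Z A : QBialg} {f : Z ⟶ pt ⊗ A} : f ∈ Cols Z (pt ⊗ A) ↔
    f ≫ fst pt A ∈ Col Z ∧ f ≫ snd pt A ∈ Cols Z A := Iff.rfl

theorem mem_cols_one {Z : QBialg} (f : Z ⟶ 𝟙_ QBialg) : f ∈ Cols Z (𝟙_ QBialg) := trivial

theorem mem_cols_congr {Z A B : QBialg} (h : A = B) {f : Z ⟶ A} :
    f ∈ Cols Z A ↔ f ≫ eqToHom h ∈ Cols Z B := by
  subst h
  simp

theorem mem_cols_tensor {Z A B : QBialg} {f : Z ⟶ A ⊗ B} : f ∈ Cols Z (A ⊗ B) ↔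
    f ≫ fst A B ∈ Cols Z A ∧ f ≫ snd A B ∈ Cols Z B := by
  induction A using objRec with
  | one =>
    have h : f ∈ Cols Z (𝟙_ QBialg ⊗ B) ↔ f ≫ (λ_ B).hom ∈ Cols Z B :=
      mem_cols_congr (IsStrictMonoidal.unit_tensor B)
    rw [h, CartesianMonoidalCategory.leftUnitor_hom]
    exact ⟨fun h => ⟨mem_cols_one _, h⟩, fun h => h.2⟩
  | cons A ih =>
    have h : f ∈ Cols Z ((pt ⊗ A) ⊗ B) ↔ f ≫ (α_ pt A B).hom ∈ Cols Z (pt ⊗ (A ⊗ B)) :=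
      mem_cols_congr (IsStrictMonoidal.tensor_assoc pt A B)
    rw [h, mem_cols_cons, ih, mem_cols_cons]
    simp [and_assoc]

theorem mem_cols_pt {Z : QBialg} {f : Z ⟶ pt} : f ∈ Cols Z pt ↔ f ∈ Col Z := by
  have h : f ∈ Cols Z pt ↔ f ≫ (ρ_ pt).inv ∈ Cols Z (pt ⊗ 𝟙_ QBialg) :=
    mem_cols_congr (IsStrictMonoidal.tensor_unit pt).symm
  rw [h, mem_cols_cons]
  simp [mem_cols_one]

/-- On components, `mul` joins, `unit` inserts the empty join, `comul` duplicates, `counit` drops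
and `swap` permutes. Quantifying over all `u` lets the induction pass through composites; `u = 𝟙 A`
then gives `mem_col`. -/
theorem comp_mem_cols {Z A B : QBialg} (f : A ⟶ B) :
    ∀ u ∈ Cols Z A, u ≫ f ∈ Cols Z B := by
  induction f using homInd with
  | hid A => simp
  | hcomp f g hf hg => exact fun u hu => by simpa using hg _ (hf _ hu)
  | htensor f g hf hg =>
    intro u hu
    rw [mem_cols_tensor] at *
    have h₁ := hf _ hu.1
    have h₂ := hg _ hu.2
    simp only [Category.assoc] at h₁ h₂
    simpa using ⟨h₁, h₂⟩
  | hmul =>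
    intro u hu
    rw [mem_cols_tensor, mem_cols_pt, mem_cols_pt] at hu
    have h : u ≫ mul = (u ≫ fst pt pt) * (u ≫ snd pt pt) := by
      rw [Hom.mul_def, ← comp_lift, lift_fst_snd, Category.comp_id]
      rfl
    rw [h, mem_cols_pt]
    exact mul_mem_col hu.1 hu.2
  | hunit =>
    intro u _
    have h : u ≫ unit = 1 := by
      rw [Hom.one_def, toUnit_unique u (toUnit Z)]
      rfl
    rw [h, mem_cols_pt]
    exact one_mem_col Z
  | hcomul =>
    intro u hu
    rw [mem_cols_tensor, ← lift_id_id]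
    simpa using hu
  | hcounit => exact fun u _ => mem_cols_one _
  | hswap =>
    intro u hu
    rw [mem_cols_tensor] at *
    rw [← braiding_pt]
    simpa using hu.symm

theorem snd_comp_mem_cols {Z A : QBialg} {f : Z ⟶ A} (hf : f ∈ Cols Z A) :
    snd pt Z ≫ f ∈ Cols (pt ⊗ Z) A := by
  induction A using objRec with
  | one => exact mem_cols_one _
  | cons A ih =>
    rw [mem_cols_cons] at *
    simp only [Category.assoc]
    exact ⟨mem_col_cons.2 ⟨_, hf.1, .inl rfl⟩, ih hf.2⟩

theorem id_mem_cols (A : QBialg) : 𝟙 A ∈ Cols A A := by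
  induction A using objRec with
  | one => exact mem_cols_one _
  | cons A ih =>
    rw [mem_cols_cons]
    -- The projection `fst` is the normal form with head present and empty tail `1`.
    refine ⟨mem_col_cons.2 ⟨1, one_mem_col A, .inr ?_⟩, ?_⟩
    · simp
    · simpa using snd_comp_mem_cols ih

theorem mem_col {A : QBialg} (f : A ⟶ pt) : f ∈ Col A := by
  simpa [mem_cols_pt] using comp_mem_cols f _ (id_mem_cols A)

/-! ### Faithfulness and fullness of the interpretation -/

theorem hom_ext_of_eval {A B : QBialg} {f g : A ⟶ B} (h : ∀ i j, Eval f i j ↔ Eval g i j) :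
    f = g := by
  induction B using objRec with
  | one => exact toUnit_unique f g
  | cons B ih =>
    apply CartesianMonoidalCategory.hom_ext
    · exact col_ext (mem_col _) (mem_col _) fun i => by simp [eval_comp, h]
    · exact ih fun i j => by simp [eval_comp, h]

theorem exists_eval_pt (A : QBialg) (v : ℕ → Prop) :
    ∃ f : A ⟶ pt, ∀ i < len A, Eval f i 0 ↔ v i := by
  induction A using objRec generalizing v with
  | one => exact ⟨1, fun i hi => absurd hi (Nat.not_lt_zero i)⟩
  | cons A ih =>
    obtain ⟨g, hg⟩ := ih fun i => v (i + 1)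
    by_cases h0 : v 0
    · refine ⟨fst pt A * (snd pt A ≫ g), fun i hi => ?_⟩
      rw [eval_hom_mul, eval_snd_comp, eval_fst, len_pt]
      rw [len_tensor, len_pt] at hi
      cases i with
      | zero => simp [h0]
      | succ i => simp [hg i (by omega)]
    · refine ⟨snd pt A ≫ g, fun i hi => ?_⟩
      rw [eval_snd_comp]
      rw [len_tensor, len_pt] at hi
      cases i with
      | zero => simp [h0]
      | succ i => simp [hg i (by omega)]

theorem exists_eval (A B : QBialg) (R : ℕ → ℕ → Prop) :
    ∃ f : A ⟶ B, ∀ i < len A, ∀ j < len B, Eval f i j ↔ R i j := by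
  induction B using objRec generalizing R with
  | one => exact ⟨toUnit A, fun i _ j hj => absurd hj (Nat.not_lt_zero j)⟩
  | cons B ih =>
    obtain ⟨f, hf⟩ := exists_eval_pt A fun i => R i 0
    obtain ⟨g, hg⟩ := ih fun i j => R i (j + 1)
    refine ⟨lift f g, fun i hi j hj => ?_⟩
    rw [eval_lift, len_pt]
    rw [len_tensor, len_pt] at hj
    cases j with
    | zero => simp [hf i hi]
    | succ j =>
      -- A morphism into `pt` takes only the value `0`, so column `j + 1` comes from `g` alone.
      have : ¬ Eval f i (j + 1) := fun h => by have := h.lt_right; rw [len_pt] at this; omega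
      simp [this, hg i hi j (by omega)]

end QBialg
end Bialg

/-! ### Strict monoidal equivalences from fully faithful functors bijective on objects -/

section StrictFunctors

variable {C : Type u₁} {D : Type u₂} [Category.{v₁} C] [Category.{v₂} D]

/-- A fully faithful functor that is bijective on objects has a strict right inverse. -/
theorem exists_rightInverse_of_bijective (F : C ⥤ D) [F.Full] [F.Faithful] (g : D → C)
    (hg : ∀ Y, F.obj (g Y) = Y) :
    ∃ (G : D ⥤ C) (_ : ∀ Y, G.obj Y = g Y) (hG : ∀ Y, F.obj (G.obj Y) = Y),
      ∀ {Y Z : D} (f : Y ⟶ Z), F.map (G.map f) = eqToHom (hG Y) ≫ f ≫ eqToHom (hG Z).symm :=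
  ⟨{ obj := g
     map := fun {Y Z} f => F.preimage (eqToHom (hg Y) ≫ f ≫ eqToHom (hg Z).symm)
     map_id := fun Y => F.map_injective (by simp)
     map_comp := fun f f' => F.map_injective (by simp) },
    fun _ => rfl, hg, fun _ => F.map_preimage _⟩

variable [MonoidalCategory C] [MonoidalCategory D]

theorem eqToHom_tensorHom_eqToHom {A B A' B' : C} (h : A = B) (h' : A' = B') :
    eqToHom h ⊗ₘ eqToHom h' = eqToHom (by rw [h, h'] : A ⊗ A' = B ⊗ B') := by
  subst h h'
  simp

variable [IsStrictMonoidal C] [IsStrictMonoidal D]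

/-- A functor between strict monoidal categories that commutes with the tensor product is
monoidal. -/
@[reducible]
def monoidalOfStrict (F : C ⥤ D) (hunit : 𝟙_ D = F.obj (𝟙_ C))
    (htensor : ∀ A B : C, F.obj A ⊗ F.obj B = F.obj (A ⊗ B))
    (hmap : ∀ {A B A' B' : C} (f : A ⟶ B) (g : A' ⟶ B'),
      (F.map f ⊗ₘ F.map g) ≫ eqToHom (htensor B B') = eqToHom (htensor A A') ≫ F.map (f ⊗ₘ g)) :
    F.Monoidal :=
  Functor.CoreMonoidal.toMonoidal
    { εIso := eqToIso hunit
      μIso := fun A B => eqToIso (htensor A B)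
      μIso_hom_natural_left := fun f A => by
        simpa using hmap f (𝟙 A)
      μIso_hom_natural_right := fun A f => by
        simpa using hmap (𝟙 A) f
      -- By strictness every structural morphism is an `eqToHom`, so the coherence laws compare
      -- parallel ones.
      associativity := fun A B E => by
        simp [IsStrictMonoidal.associator_eq, eqToHom_map]
      left_unitality := fun A => by
        simp [IsStrictMonoidal.leftUnitor_eq, eqToHom_map]
      right_unitality := fun A => by
        simp [IsStrictMonoidal.rightUnitor_eq, eqToHom_map] }

theorem monoidalOfStrict_isStrict (F : C ⥤ D) (hunit : 𝟙_ D = F.obj (𝟙_ C))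
    (htensor : ∀ A B : C, F.obj A ⊗ F.obj B = F.obj (A ⊗ B))
    (hmap : ∀ {A B A' B' : C} (f : A ⟶ B) (g : A' ⟶ B'),
      (F.map f ⊗ₘ F.map g) ≫ eqToHom (htensor B B') = eqToHom (htensor A A') ≫ F.map (f ⊗ₘ g)) :
    letI := monoidalOfStrict F hunit htensor hmap
    IsStrictMonoidalFunctor F :=
  letI := monoidalOfStrict F hunit htensor hmap
  { obj_unit := hunit
    obj_tensor := htensor
    ε_eq := rfl
    μ_eq := fun _ _ => rfl }

/-- A fully faithful functor between strict monoidal categories that is bijective on objects and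
commutes with the tensor product gives a monoidal equivalence. -/
theorem monoidallyEquivalent_of_bijective (F : C ⥤ D) [F.Full] [F.Faithful]
    (hunit : 𝟙_ D = F.obj (𝟙_ C)) (htensor : ∀ A B : C, F.obj A ⊗ F.obj B = F.obj (A ⊗ B))
    (hmap : ∀ {A B A' B' : C} (f : A ⟶ B) (g : A' ⟶ B'),
      (F.map f ⊗ₘ F.map g) ≫ eqToHom (htensor B B') = eqToHom (htensor A A') ≫ F.map (f ⊗ₘ g))
    (g : D → C) (hg : ∀ Y, F.obj (g Y) = Y) (hg' : ∀ A, g (F.obj A) = A) :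
    MonoidallyEquivalent C D := by
  obtain ⟨G, hobj, hFG, hGmap⟩ := exists_rightInverse_of_bijective F g hg
  have hGF (A : C) : G.obj (F.obj A) = A := (hobj _).trans (hg' A)
  have hunitG : 𝟙_ C = G.obj (𝟙_ D) := ((congrArg G.obj hunit).trans (hGF _)).symm
  have htensorG (Y Z : D) : G.obj Y ⊗ G.obj Z = G.obj (Y ⊗ Z) := by
    have h := htensor (G.obj Y) (G.obj Z)
    rw [hFG, hFG] at h
    exact ((congrArg G.obj h).trans (hGF _)).symm
  have hmapG {Y Z Y' Z' : D} (f : Y ⟶ Z) (f' : Y' ⟶ Z') :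
      (G.map f ⊗ₘ G.map f') ≫ eqToHom (htensorG Z Z') =
        eqToHom (htensorG Y Y') ≫ G.map (f ⊗ₘ f') := by
    -- Under the faithful `F`, each `G.map f` becomes `f` up to `eqToHom`, which reduces the claim
    -- to `hmap`.
    apply F.map_injective
    have h := eqToHom (htensor (G.obj Y) (G.obj Y')).symm ≫= hmap (G.map f) (G.map f')
    rw [eqToHom_trans_assoc, eqToHom_refl, Category.id_comp] at h
    simp only [Functor.map_comp, eqToHom_map, hGmap, ← h, ← tensorHom_comp_tensorHom,
      eqToHom_tensorHom_eqToHom]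
    simp
  have hG (A : C) : (𝟭 C).obj A = (F ⋙ G).obj A := (hGF A).symm
  have hF (Y : D) : (G ⋙ F).obj Y = (𝟭 D).obj Y := hFG Y
  let _ := monoidalOfStrict F hunit htensor hmap
  let _ := monoidalOfStrict G hunitG htensorG hmapG
  have hFs := monoidalOfStrict_isStrict F hunit htensor hmap
  have hGs := monoidalOfStrict_isStrict G hunitG htensorG hmapG
  refine ⟨F, G, inferInstance, inferInstance, hFs, hGs,
    NatIso.ofComponents (fun A => eqToIso (hG A)) ?_,
    NatIso.ofComponents (fun Y => eqToIso (hF Y)) ?_, ⟨?_, ?_⟩, ⟨?_, ?_⟩⟩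
  · intro A B f
    apply F.map_injective
    simp only [Functor.id_map, Functor.comp_map, eqToIso.hom, Functor.map_comp, eqToHom_map,
      hGmap]
    simp
  · intro Y Z f
    simp only [Functor.id_map, Functor.comp_map, eqToIso.hom, hGmap]
    simp
  · simp [Functor.LaxMonoidal.comp_ε, hFs.ε_eq, hGs.ε_eq, eqToHom_map]
  · intro A B
    simp only [NatIso.ofComponents_hom_app, eqToIso.hom, Functor.LaxMonoidal.comp_μ, hFs.μ_eq,
      hGs.μ_eq, eqToHom_map, eqToHom_tensorHom_eqToHom, Functor.LaxMonoidal.id_μ, eqToHom_trans,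
      Category.id_comp]
  · simp [Functor.LaxMonoidal.comp_ε, hFs.ε_eq, hGs.ε_eq, eqToHom_map]
  · intro A B
    simp only [NatIso.ofComponents_hom_app, eqToIso.hom, Functor.LaxMonoidal.comp_μ, hFs.μ_eq,
      hGs.μ_eq, eqToHom_map, eqToHom_tensorHom_eqToHom, Functor.LaxMonoidal.id_μ, eqToHom_trans,
      Category.comp_id]

end StrictFunctors

/-! ### The functor to finite ordinals and relations -/

namespace FinOrdRel

theorem eqToHom_apply {m n : ℕ} (h : m = n) (i : Fin m) (j : Fin n) :
    @eqToHom FinOrdRel _ m n h i j ↔ (i : ℕ) = j := by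
  subst h
  exact Fin.ext_iff

theorem comp_apply {m n p : ℕ} (R : @Quiver.Hom FinOrdRel _ m n)
    (S : @Quiver.Hom FinOrdRel _ n p) (i : Fin m) (k : Fin p) :
    @CategoryStruct.comp FinOrdRel _ m n p R S i k ↔ ∃ j : Fin n, R i j ∧ S j k :=
  Iff.rfl

theorem tensorHom_apply {m n m' n' : ℕ} (R : @Quiver.Hom FinOrdRel _ m n)
    (R' : @Quiver.Hom FinOrdRel _ m' n') (i : Fin (m + m')) (j : Fin (n + n')) :
    @tensorHom FinOrdRel _ _ m n m' n' R R' i j ↔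
      (∃ (a : Fin m) (b : Fin n), (i : ℕ) = a ∧ (j : ℕ) = b ∧ R a b) ∨
      (∃ (a : Fin m') (b : Fin n'), (i : ℕ) = m + a ∧ (j : ℕ) = n + b ∧ R' a b) :=
  sumRel_iff R R' i j

end FinOrdRel

namespace Bialg
namespace QBialg

/-- The interpretation of the generated category in finite ordinals and relations. -/
def toRel : QBialg ⥤ FinOrdRel where
  obj A := len A
  map {A B} f := fun (i : Fin (len A)) (j : Fin (len B)) => Eval f i j
  map_id A := by
    refine funext₂ fun (i j : Fin (len A)) => propext ?_
    exact (eval_id A i j).trans ⟨fun h => Fin.ext h.1, fun h => ⟨congrArg Fin.val h, i.2⟩⟩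
  map_comp {A B C} f g := by
    refine funext₂ fun (i : Fin (len A)) (j : Fin (len C)) => propext ?_
    exact (eval_comp f g i j).trans
      ⟨fun ⟨k, hf, hg⟩ => ⟨⟨k, hf.lt_right⟩, hf, hg⟩, fun ⟨k, hf, hg⟩ => ⟨k, hf, hg⟩⟩

instance : toRel.Faithful where
  map_injective {A B} f g h := by
    have h' (i : Fin (len A)) (j : Fin (len B)) : Eval f i j ↔ Eval g i j :=
      iff_of_eq (congrFun₂ h i j)
    exact hom_ext_of_eval fun i j =>
      ⟨fun hf => (h' ⟨i, hf.lt_left⟩ ⟨j, hf.lt_right⟩).1 hf,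
        fun hg => (h' ⟨i, hg.lt_left⟩ ⟨j, hg.lt_right⟩).2 hg⟩

instance : toRel.Full where
  map_surjective {A B} R := by
    obtain ⟨f, hf⟩ := exists_eval A B fun i j =>
      ∃ (hi : i < len A) (hj : j < len B), R ⟨i, hi⟩ ⟨j, hj⟩
    refine ⟨f, funext₂ fun (i : Fin (len A)) (j : Fin (len B)) => propext ?_⟩
    exact (hf i i.2 j j.2).trans ⟨fun ⟨_, _, h⟩ => h, fun h => ⟨i.2, j.2, h⟩⟩

theorem toRel_obj_tensor (A B : QBialg) :
    toRel.obj A ⊗ toRel.obj B = toRel.obj (A ⊗ B) :=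
  (len_tensor A B).symm

theorem toRel_map_tensor {A B C D : QBialg} (f : A ⟶ B) (g : C ⟶ D) :
    (toRel.map f ⊗ₘ toRel.map g) ≫ eqToHom (toRel_obj_tensor B D) =
      eqToHom (toRel_obj_tensor A C) ≫ toRel.map (f ⊗ₘ g) := by
  refine funext₂ fun (i : Fin (len A + len C)) (j : Fin (len (B ⊗ D))) => propext ?_
  -- The two `eqToHom` factors preserve underlying natural numbers, so both sides reduce to
  -- relations on those numbers.
  have hr : (eqToHom (toRel_obj_tensor A C) ≫ toRel.map (f ⊗ₘ g)) i j ↔ Eval (f ⊗ₘ g) i j := by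
    refine (FinOrdRel.comp_apply _ _ i j).trans ⟨?_, fun h => ?_⟩
    · rintro ⟨k, hk, h⟩
      have e : (i : ℕ) = Fin.val (n := len (A ⊗ C)) k :=
        (FinOrdRel.eqToHom_apply (len_tensor A C).symm i k).1 hk
      rw [e]
      exact h
    · exact ⟨⟨i, h.lt_left⟩, (FinOrdRel.eqToHom_apply (len_tensor A C).symm _ _).2 rfl, h⟩
  have hl : ((toRel.map f ⊗ₘ toRel.map g) ≫ eqToHom (toRel_obj_tensor B D)) i j ↔
      (toRel.map f ⊗ₘ toRel.map g) i (j.cast (len_tensor B D)) := by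
    refine (FinOrdRel.comp_apply _ _ i j).trans ⟨?_, fun h => ?_⟩
    · rintro ⟨k, h, hk⟩
      have e : Fin.val (n := len B + len D) k = j :=
        (FinOrdRel.eqToHom_apply (len_tensor B D).symm k j).1 hk
      rwa [show k = j.cast (len_tensor B D) from Fin.ext e] at h
    · exact ⟨_, h, (FinOrdRel.eqToHom_apply (len_tensor B D).symm _ _).2 rfl⟩
  rw [hr, eval_tensor]
  refine hl.trans ((FinOrdRel.tensorHom_apply _ _ i (j.cast (len_tensor B D))).trans ⟨?_, ?_⟩)
  · rintro (⟨a, b, ha, hb, h⟩ | ⟨a, b, ha, hb, h⟩)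
    · refine .inl ?_
      rw [ha, show (j : ℕ) = b from hb]
      exact h
    · refine .inr ?_
      rw [ha, show (j : ℕ) = len B + b from hb, Nat.add_sub_cancel_left, Nat.add_sub_cancel_left]
      exact ⟨Nat.le_add_right _ _, Nat.le_add_right _ _, h⟩
  · rintro (h | ⟨hi, hj, h⟩)
    · exact .inl ⟨⟨i, h.lt_left⟩, ⟨j, h.lt_right⟩, rfl, rfl, h⟩
    · exact .inr ⟨⟨_, h.lt_left⟩, ⟨_, h.lt_right⟩, (Nat.add_sub_cancel' hi).symm,
        (Nat.add_sub_cancel' hj).symm, h⟩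

end QBialg
end Bialg

/-- Words over a one-letter alphabet are determined by their length, so `List.replicate` inverts
`toRel` on objects. -/
theorem mainTheorem3 : Bialg.qualitativeTheory.Presents FinOrdRel :=
  monoidallyEquivalent_of_bijective Bialg.QBialg.toRel rfl Bialg.QBialg.toRel_obj_tensor
    Bialg.QBialg.toRel_map_tensor (fun n => (List.replicate n () : List Unit))
    (fun _ => List.length_replicate) (fun _ => (List.eq_replicate_of_mem (fun _ _ => rfl)).symm)
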